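/- Let $k$ be a field, $R=k[[x,y]]/(xy)$, $N_+=R/(x)$ and $N_-=R/(y)$. A finitely generated $R$-module $M$ is called maximal Cohen--Macaulay (MCM) if $M=0$ or $\operatorname{depth}_R M=\dim R$, and $\operatorname{add}M$ denotes the class of direct summands of finite direct sums of copies of $M$. Global dimensions are taken with respect to right modules. Then the global spectrum of $R$, i.e. the set of all finite values of $\operatorname{gldim}\operatorname{End}_R(M)$ where $M$ runs over the nonzero MCM $R$-modules, is $$\operatorname{gs}(R)=\{1,2,3\}.$$ Moreover, the three values are realized as follows. (1) The normalization $\widetilde R$ of $R$ (its integral closure in its total ring of fractions) is an MCM $R$-module, is isomorphic to $N_+\oplus N_-$ as an $R$-module, and $\operatorname{gldim}\operatorname{End}_R(\widetilde R)=1$. (2) $M=R\oplus N_+\oplus N_-$ is a representation generator, i.e. $M$ is MCM and every indecomposable MCM $R$-module is a direct summand of $M$, and $\operatorname{gldim}\operatorname{End}_R(M)=2$. (3) For each of $M=R\oplus N_+$ and $M=R\oplus N_-$, the module $M$ is cluster-tilting, i.e. $M$ is MCM and $$\operatorname{add}M=\{X\ \text{MCM}\mid \operatorname{Ext}^1_R(X,M)=0\}=\{X\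 \text{MCM}\mid \operatorname{Ext}^1_R(M,X)=0\},$$ and $\operatorname{gldim}\operatorname{End}_R(M)=3$. -/

import Mathlib

universe u

open CategoryTheory

noncomputable section

namespace NodeSpectrum

/-! ### General notions -/

/-- The (left) global dimension of a ring `A`: the supremum of the projective dimensions of all
left `A`-modules (with value `⊥` for the zero ring). The right global dimension of `A` is
`globalDim Aᵐᵒᵖ`. -/
def globalDim (A : Type u) [Ring A] : WithBot ℕ∞ :=
  ⨆ X : ModuleCat.{u} A, projectiveDimension X

/-- The global dimension of `End_R(M)`, computed with right modules over `End_R(M)` (where the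
product is composition of maps), i.e. with left modules over the opposite ring. -/
def globalDimEnd (R : Type u) [CommRing R] (M : Type u) [AddCommGroup M] [Module R M] :
    WithBot ℕ∞ :=
  globalDim (Module.End R M)ᵐᵒᵖ

/-- The depth of a module over a local ring: the supremum of the lengths of the `M`-regular
sequences in the maximal ideal. -/
def depth (R : Type u) [CommRing R] [IsLocalRing R] (M : Type u) [AddCommGroup M] [Module R M] :
    ℕ∞ :=
  ⨆ (rs : List R) (_ : (∀ r ∈ rs, r ∈ IsLocalRing.maximalIdeal R) ∧
    RingTheory.Sequence.IsRegular M rs), (rs.length : ℕ∞)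

/-- Maximal Cohen-Macaulay modules over a (Noetherian) local ring: finitely generated modules `M`
which are zero or satisfy `depth M = dim R`. Full support is not required. -/
structure IsMCM (R : Type u) [CommRing R] [IsLocalRing R]
    (M : Type u) [AddCommGroup M] [Module R M] : Prop where
  finite : Module.Finite R M
  depth_eq : Subsingleton M ∨ (depth R M : WithBot ℕ∞) = ringKrullDim R

/-- The global spectrum of a local (Cohen-Macaulay) ring: all natural numbers which occur as the
global dimension of `End_R(M)` for a nonzero maximal Cohen-Macaulay module `M`. -/
def globalSpectrum (R : Type u) [CommRing R] [IsLocalRing R] : Set ℕ :=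
  {n | ∃ (M : Type u) (_ : AddCommGroup M) (_ : Module R M),
    IsMCM R M ∧ Nontrivial M ∧ globalDimEnd R M = n}

/-- `X` is (isomorphic to) a direct summand of `M`. -/
def IsDirectSummand (R : Type u) [CommRing R] (X M : Type u) [AddCommGroup X] [Module R X]
    [AddCommGroup M] [Module R M] : Prop :=
  ∃ (i : X →ₗ[R] M) (p : M →ₗ[R] X), p ∘ₗ i = LinearMap.id

/-- `X` lies in `add M`: it is a direct summand of a finite direct sum of copies of `M`. -/
def InAdd (R : Type u) [CommRing R] (M X : Type u) [AddCommGroup M] [Module R M]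
    [AddCommGroup X] [Module R X] : Prop :=
  ∃ n : ℕ, IsDirectSummand R X (Fin n → M)

/-- `X` is indecomposable: nonzero, and not an internal direct sum of two nonzero submodules. -/
structure IsIndecomposable (R : Type u) [CommRing R] (X : Type u) [AddCommGroup X] [Module R X] :
    Prop where
  nontrivial : Nontrivial X
  eq_bot_or_eq_bot : ∀ P Q : Submodule R X, IsCompl P Q → P = ⊥ ∨ Q = ⊥

/-- `M` is a representation generator: it is maximal Cohen-Macaulay and every indecomposable
maximal Cohen-Macaulay module is a direct summand of `M`. -/
structure IsRepresentationGenerator (R : Type u) [CommRing R] [IsLocalRing R]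
    (M : Type u) [AddCommGroup M] [Module R M] : Prop where
  isMCM : IsMCM R M
  summand : ∀ (X : Type u) [AddCommGroup X] [Module R X],
    IsMCM R X → IsIndecomposable R X → IsDirectSummand R X M

/-- `Ext¹_R(X, Y) = 0`. -/
def ExtOneVanishes (R : Type u) [CommRing R] (X Y : Type u) [AddCommGroup X] [Module R X]
    [AddCommGroup Y] [Module R Y] : Prop :=
  Subsingleton (Abelian.Ext (ModuleCat.of R X) (ModuleCat.of R Y) 1)

/-- `M` is cluster-tilting: it is maximal Cohen-Macaulay and
`add M = {X ∈ MCM(R) | Ext¹(X, M) = 0} = {X ∈ MCM(R) | Ext¹(M, X) = 0}`. -/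
structure IsClusterTilting (R : Type u) [CommRing R] [IsLocalRing R]
    (M : Type u) [AddCommGroup M] [Module R M] : Prop where
  isMCM : IsMCM R M
  inAdd_iff_left : ∀ (X : Type u) [AddCommGroup X] [Module R X],
    InAdd R M X ↔ IsMCM R X ∧ ExtOneVanishes R X M
  inAdd_iff_right : ∀ (X : Type u) [AddCommGroup X] [Module R X],
    InAdd R M X ↔ IsMCM R X ∧ ExtOneVanishes R M X

/-- The normalization of `R`: its integral closure in its total ring of fractions (the
localization at all nonzerodivisors). -/
abbrev Normalization (R : Type u) [CommRing R] : Type u :=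
  integralClosure R (FractionRing R)

/-! ### The node -/

/-- The node `k[[x,y]]/(xy)`, where `x` and `y` are the variables `0` and `1`. -/
abbrev Node (k : Type u) [Field k] : Type u :=
  MvPowerSeries (Fin 2) k ⧸
    Ideal.span {(MvPowerSeries.X 0 * MvPowerSeries.X 1 : MvPowerSeries (Fin 2) k)}

/-- The class of `x` in the node. -/
def Node.x (k : Type u) [Field k] : Node k := Ideal.Quotient.mk _ (MvPowerSeries.X 0)

/-- The class of `y` in the node. -/
def Node.y (k : Type u) [Field k] : Node k := Ideal.Quotient.mk _ (MvPowerSeries.X 1)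

instance Node.nontrivial (k : Type u) [Field k] : Nontrivial (Node k) := by
  refine Ideal.Quotient.nontrivial_iff.mpr fun h => ?_
  have h1 := Ideal.span_singleton_eq_top.mp h
  have h2 := h1.map (MvPowerSeries.constantCoeff (σ := Fin 2) (R := k))
  simp at h2

instance Node.isLocalRing (k : Type u) [Field k] : IsLocalRing (Node k) :=
  IsLocalRing.of_surjective' (Ideal.Quotient.mk _) Ideal.Quotient.mk_surjective

/-- `N₊ = R/x`. -/
abbrev NPlus (k : Type u) [Field k] : Type u := Node k ⧸ Ideal.span {Node.x k}

/-- `N₋ = R/y`. -/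
abbrev NMinus (k : Type u) [Field k] : Type u := Node k ⧸ Ideal.span {Node.y k}

end NodeSpectrum

end

/-! Everything rests on a classification: over a node, the finitely generated modules on which `x +
y` is regular are the sums R^a ⊕ (R/x)^b ⊕ (R/y)^c (`IsNode.exists_equiv`), and these are exactly
the MCM modules (`IsNode.isMCM_iff`). The free part comes from a basis of M modulo ker x + ker y,
and the other two from completing the elements x m_i and y m_i to bases of ker y and ker x over the
branches R/y and R/x.

Let E = End_R(M). A right ideal of E is the image of Hom(M, G) for some G : M^n → M; the kernel of
this map is Hom(M, ker G), and ker G is again MCM. By Auslander's theorem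
(`globalDim_le_of_quotient`) the global dimension of E is then governed by the modules Hom(M, N)
with N one of R, R/x, R/y. They are projective for N in add M; otherwise 0 → R/y → R → R/x → 0 or
its mirror image resolves them. If M has no free summand, every G splits onto its image, and the
value is 1. If all three types occur, Hom(M, ker G) is projective, and the value is 2. If R and just
one branch occur, the missing branch costs one further step, and the value is 3. If M is free, the
two sequences alternate forever and the dimension is infinite. The lower bound 1 is Nakayama's
lemma; in the other cases a splitting would make x invertible modulo y, or y modulo x.

The same sequence computes Ext¹(R/x, W) as the elements of W killed by y, modulo xW. This is nonzero
for W = R/y and zero for W = R and R/x, which gives cluster tilting. The normalization is cut into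
branches by the idempotents y/(x+y) and x/(x+y). -/

namespace NodeSpectrum

/-! ### Projective dimension, Ext¹ and Auslander's theorem -/

section Homological

variable {A : Type u} [Ring A] {X Y Z : Type u} [AddCommGroup X] [Module A X] [AddCommGroup Y]
  [Module A Y] [AddCommGroup Z] [Module A Z]

theorem hasProjectiveDimensionLT_one_iff :
    HasProjectiveDimensionLT (ModuleCat.of A X) 1 ↔ Module.Projective A X := by
  rw [← projective_iff_hasProjectiveDimensionLT_one, ← IsProjective.iff_projective]

/-- The short complex of modules attached to an exact pair of linear maps. -/
abbrev exactComplex {f : X →ₗ[A] Y} {g : Y →ₗ[A] Z} (hfg : Function.Exact f g) :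
    ShortComplex (ModuleCat.{u} A) :=
  ShortComplex.mk (ModuleCat.ofHom f) (ModuleCat.ofHom g)
    (by rw [← ModuleCat.ofHom_comp, hfg.linearMap_comp_eq_zero]; rfl)

theorem exactComplex_shortExact {f : X →ₗ[A] Y} {g : Y →ₗ[A] Z} (hf : Function.Injective f)
    (hfg : Function.Exact f g) (hg : Function.Surjective g) :
    (exactComplex hfg).ShortExact :=
  ModuleCat.shortComplex_shortExact _ hfg hf hg

theorem hasProjectiveDimensionLT_iff_of_exact [Module.Projective A Y] {f : X →ₗ[A] Y}
    {g : Y →ₗ[A] Z} (hf : Function.Injective f) (hfg : Function.Exact f g)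
    (hg : Function.Surjective g) (n : ℕ) :
    HasProjectiveDimensionLT (ModuleCat.of A Z) (n + 2) ↔
      HasProjectiveDimensionLT (ModuleCat.of A X) (n + 1) :=
  (exactComplex_shortExact hf hfg hg).hasProjectiveDimensionLT_X₃_iff n
    ((IsProjective.iff_projective Y).mp inferInstance)

/-- Since Ext¹(Y, W) = 0, the long exact sequence makes Ext¹(Z, W) the cokernel of restriction
Hom(Y, W) → Hom(X, W). -/
theorem ext_one_subsingleton_iff [Module.Projective A Y] {f : X →ₗ[A] Y} {g : Y →ₗ[A] Z}
    (hf : Function.Injective f) (hfg : Function.Exact f g) (hg : Function.Surjective g)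
    (W : Type u) [AddCommGroup W] [Module A W] :
    Subsingleton (Abelian.Ext (ModuleCat.of A Z) (ModuleCat.of A W) 1) ↔
      ∀ φ : X →ₗ[A] W, ∃ ψ : Y →ₗ[A] W, ψ ∘ₗ f = φ := by
  have hS := exactComplex_shortExact hf hfg hg
  constructor
  · intro h φ
    obtain ⟨ψ, hψ⟩ := Abelian.Ext.contravariant_sequence_exact₁ hS (ModuleCat.of A W)
      (Abelian.Ext.mk₀ (ModuleCat.ofHom φ)) (add_zero 1) (Subsingleton.elim _ _)
    obtain ⟨ψ, rfl⟩ := Abelian.Ext.homEquiv₀.symm.surjective ψ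
    refine ⟨ψ.hom, ?_⟩
    have : (exactComplex hfg).f ≫ ψ = ModuleCat.ofHom φ :=
      Abelian.Ext.homEquiv₀.symm.injective (by simpa using hψ)
    exact congrArg ModuleCat.Hom.hom this
  · intro h
    have hP : Projective (ModuleCat.of A Y) := (IsProjective.iff_projective Y).mp inferInstance
    refine subsingleton_of_forall_eq 0 fun e => ?_
    obtain ⟨φ, rfl⟩ := Abelian.Ext.contravariant_sequence_exact₃ hS (ModuleCat.of A W) e
      (Abelian.Ext.eq_zero_of_projective (P := ModuleCat.of A Y) _) (add_zero 1)
    obtain ⟨φ, rfl⟩ := Abelian.Ext.homEquiv₀.symm.surjective φ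
    obtain ⟨ψ, hψ⟩ := h φ.hom
    have : φ = (exactComplex hfg).f ≫ ModuleCat.ofHom ψ := by
      ext1; exact hψ.symm
    subst this
    have := hS.extClass_comp_assoc (Abelian.Ext.mk₀ (ModuleCat.ofHom ψ)) (h := add_zero 1)
    simpa using this

theorem baer_of_ext_one (h : ∀ J : Submodule A A,
    Subsingleton (Abelian.Ext (ModuleCat.of A (A ⧸ J)) (ModuleCat.of A X) 1)) :
    Module.Baer A X := by
  intro J φ
  obtain ⟨ψ, hψ⟩ := (ext_one_subsingleton_iff (Submodule.injective_subtype J)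
    (LinearMap.exact_subtype_mkQ J) J.mkQ_surjective X).mp (h J) φ
  exact ⟨ψ, fun a ha => LinearMap.congr_fun hψ ⟨a, ha⟩⟩

/-- Dimension shifting along an embedding of `Q` into an injective reduces to `n = 0`, which is
Baer's criterion. -/
theorem hasInjectiveDimensionLT_of_ext_quotient (n : ℕ) (Q : ModuleCat.{u} A)
    (h : ∀ J : Submodule A A, Subsingleton (Abelian.Ext (ModuleCat.of A (A ⧸ J)) Q (n + 1))) :
    HasInjectiveDimensionLT Q (n + 1) := by
  induction n generalizing Q with
  | zero =>
    rw [← injective_iff_hasInjectiveDimensionLT_one]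
    exact (Module.injective_iff_injective_object A Q).mp (baer_of_ext_one h).injective
  | succ n ih =>
    obtain ⟨I, _, f, _⟩ := EnoughInjectives.presentation Q
    have hS : (ShortComplex.mk f (Limits.cokernel.π f) (by simp)).ShortExact :=
      { exact := ShortComplex.exact_cokernel f }
    refine (hS.hasInjectiveDimensionLT_X₃_iff n inferInstance).mp (ih _ fun J => ?_)
    refine subsingleton_of_forall_eq 0 fun e => ?_
    obtain ⟨e', rfl⟩ := Abelian.Ext.covariant_sequence_exact₃ _ hS e rfl
      ((h J).elim _ _)
    rw [Abelian.Ext.eq_zero_of_injective e', Abelian.Ext.zero_comp]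

/-- Auslander's theorem: the global dimension is bounded by the projective dimensions of the cyclic
modules. -/
theorem globalDim_le_of_quotient (n : ℕ) (h : ∀ J : Submodule A A,
    HasProjectiveDimensionLT (ModuleCat.of A (A ⧸ J)) (n + 1)) : globalDim A ≤ n := by
  refine iSup_le fun W => (projectiveDimension_le_iff W n).mpr ?_
  refine (hasProjectiveDimensionLT_iff W (n + 1)).mpr fun i hi Q e => ?_
  -- The bound on cyclic modules is turned into a bound on the injective dimension of every target
  -- `Q`, which kills Ext from an arbitrary `W`.
  have := hasInjectiveDimensionLT_of_ext_quotient n Q fun J => (h J).subsingleton _ _ _ le_rfl _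
  exact Abelian.Ext.eq_zero_of_hasInjectiveDimensionLT e (n + 1) hi

theorem hasProjectiveDimensionLT_of_globalDim_le {n : ℕ} (h : globalDim A ≤ n) :
    HasProjectiveDimensionLT (ModuleCat.of A X) (n + 1) :=
  (projectiveDimension_le_iff _ n).mp ((le_iSup _ _).trans h)

theorem le_globalDim_of_not_hasProjectiveDimensionLT (n : ℕ)
    (h : ¬ HasProjectiveDimensionLT (ModuleCat.of A X) n) : (n : WithBot ℕ∞) ≤ globalDim A :=
  ((projectiveDimension_ge_iff _ n).mpr h).trans (le_iSup projectiveDimension (ModuleCat.of A X))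

end Homological

/-- An abstract node: a Noetherian local ring whose maximal ideal is generated by two elements `x`
and `y` with `x * y = 0` which generate distinct incomparable prime ideals. -/
structure IsNode (R : Type u) [CommRing R] [IsLocalRing R] (x y : R) : Prop where
  noetherian : IsNoetherianRing R
  maximalIdeal_eq : IsLocalRing.maximalIdeal R = Ideal.span {x, y}
  prime_x : (Ideal.span {x}).IsPrime
  prime_y : (Ideal.span {y}).IsPrime
  x_notMem : x ∉ Ideal.span {y}
  y_notMem : y ∉ Ideal.span {x}
  mul_eq_zero : x * y = 0

/-! ### Families independent modulo the maximal ideal -/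

section Families

variable {R : Type u} [CommRing R] {M : Type u} [AddCommGroup M] [Module R M]

/-- The linear map out of a power of `R ⧸ (z)` given by a family of elements killed by `z`. -/
noncomputable def quotHom (z : R) {ι : Type*} [Fintype ι] (v : ι → M) (hv : ∀ i, z • v i = 0) :
    (ι → R ⧸ Ideal.span {z}) →ₗ[R] M :=
  ∑ i, ((Ideal.span {z}).liftQ (LinearMap.toSpanSingleton R M (v i))
    (by rw [Ideal.span, Submodule.span_le]; simpa using hv i)) ∘ₗ LinearMap.proj i

theorem quotHom_mk (z : R) {ι : Type*} [Fintype ι] (v : ι → M) (hv : ∀ i, z • v i = 0)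
    (r : ι → R) : quotHom z v hv (fun i => Ideal.Quotient.mk _ (r i)) = ∑ i, r i • v i := by
  simp only [quotHom, LinearMap.sum_apply, LinearMap.comp_apply, LinearMap.proj_apply]
  exact Finset.sum_congr rfl fun i _ => rfl

theorem exists_eq_mk {I : Ideal R} {ι : Type*} (f : ι → R ⧸ I) :
    ∃ r : ι → R, f = fun i => Ideal.Quotient.mk I (r i) :=
  ⟨fun i => (Ideal.Quotient.mk_surjective (f i)).choose,
    funext fun i => (Ideal.Quotient.mk_surjective (f i)).choose_spec.symm⟩

theorem eq_zero_of_smul {x y : R} (hM : IsSMulRegular M (x + y)) {m : M}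
    (hx : x • m = 0) (hy : y • m = 0) :
    m = 0 :=
  (isSMulRegular_iff_right_eq_zero_of_smul.mp hM) m (by rw [add_smul, hx, hy, add_zero])

variable [IsLocalRing R] [Module.Finite R M]

theorem exists_residue_basis
    (hM : ∀ r ∈ IsLocalRing.maximalIdeal R, ∀ m : M, r • m = 0) :
    ∃ (b : ℕ) (w : Fin b → M), Submodule.span R (Set.range w) = ⊤ ∧
      ∀ c : Fin b → R, ∑ i, c i • w i = 0 → ∀ i, c i ∈ IsLocalRing.maximalIdeal R := by
  have ht : Module.IsTorsionBySet R M (IsLocalRing.maximalIdeal R : Set R) := fun m r => hM r r.2 m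
  let _ : Module (R ⧸ IsLocalRing.maximalIdeal R) M := ht.module
  let _ : Field (R ⧸ IsLocalRing.maximalIdeal R) := Ideal.Quotient.field _
  have : IsScalarTower R (R ⧸ IsLocalRing.maximalIdeal R) M := ht.isScalarTower
  have : Module.Finite (R ⧸ IsLocalRing.maximalIdeal R) M := Module.Finite.of_restrictScalars_finite R _ _
  let b := Module.finBasis (R ⧸ IsLocalRing.maximalIdeal R) M
  refine ⟨_, b, ?_, fun c hc i => ?_⟩
  · refine eq_top_iff.mpr fun m _ => ?_
    rw [← b.sum_repr m]
    refine Submodule.sum_mem _ fun i _ => ?_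
    obtain ⟨r, hr⟩ := Ideal.Quotient.mk_surjective (b.repr m i)
    rw [← hr]
    exact Submodule.smul_mem _ r (Submodule.subset_span ⟨i, rfl⟩)
  · rw [← Ideal.Quotient.eq_zero_iff_mem]
    exact Fintype.linearIndependent_iff.mp b.linearIndependent
      (fun i => Ideal.Quotient.mk _ (c i)) hc i

/-- Basis extension over the residue field: `M ⧸ U` is a vector space in which `v` is independent,
and `w` lifts a basis of the quotient by the span of `v`. -/
theorem exists_residue_extension (U : Submodule R M)
    (hU : ∀ r ∈ IsLocalRing.maximalIdeal R, ∀ m : M, r • m ∈ U) {a : ℕ} (v : Fin a → M)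
    (hv : ∀ c : Fin a → R, ∑ i, c i • v i ∈ U → ∀ i, c i ∈ IsLocalRing.maximalIdeal R) :
    ∃ (b : ℕ) (w : Fin b → M),
      Submodule.span R (Set.range v) ⊔ Submodule.span R (Set.range w) ⊔ U = ⊤ ∧
      ∀ (c : Fin a → R) (d : Fin b → R), ∑ i, c i • v i + ∑ j, d j • w j ∈ U →
        (∀ i, c i ∈ IsLocalRing.maximalIdeal R) ∧ ∀ j, d j ∈ IsLocalRing.maximalIdeal R := by
  set V := U ⊔ Submodule.span R (Set.range v) with hV
  obtain ⟨b, w, hw, hi⟩ := exists_residue_basis (R := R) (M := M ⧸ V) (fun r hr m => by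
    obtain ⟨m, rfl⟩ := V.mkQ_surjective m
    rw [← map_smul, Submodule.mkQ_apply, Submodule.Quotient.mk_eq_zero]
    exact Submodule.mem_sup_left (hU r hr m))
  choose w' hw' using fun j => V.mkQ_surjective (w j)
  have hw'' : w = V.mkQ ∘ w' := funext fun j => (hw' j).symm
  refine ⟨b, w', ?_, fun c d hcd => ?_⟩
  · rw [hw'', Set.range_comp, ← Submodule.map_span, ← LinearMap.range_eq_top.mpr V.mkQ_surjective,
      ← Submodule.map_top] at hw
    have h2 := congrArg (Submodule.comap V.mkQ) hw
    rw [Submodule.comap_map_eq, Submodule.comap_map_eq, Submodule.ker_mkQ, top_sup_eq] at h2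
    rw [← h2, hV]
    ac_rfl
  · have h1 : ∀ j, d j ∈ IsLocalRing.maximalIdeal R := by
      refine hi d ?_
      have h2 : V.mkQ (∑ i, c i • v i + ∑ j, d j • w' j) = 0 := by
        rw [Submodule.mkQ_apply, Submodule.Quotient.mk_eq_zero]
        exact Submodule.mem_sup_left hcd
      have h3 : V.mkQ (∑ i, c i • v i) = 0 := by
        rw [Submodule.mkQ_apply, Submodule.Quotient.mk_eq_zero]
        exact Submodule.mem_sup_right (Submodule.sum_mem _ fun i _ =>
          Submodule.smul_mem _ _ (Submodule.subset_span ⟨i, rfl⟩))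
      rw [map_add, h3, zero_add, map_sum] at h2
      simpa only [map_smul, hw'] using h2
    refine ⟨hv c ?_, h1⟩
    have h4 : ∑ j, d j • w' j ∈ U := Submodule.sum_mem _ fun j _ => hU _ (h1 j) _
    exact (Submodule.add_mem_iff_left U h4).mp hcd

end Families

/-! ### Classification of torsion-free modules over a node -/

namespace IsNode

variable {R : Type u} [CommRing R] [IsLocalRing R] {x y : R} (h : IsNode R x y)
include h

theorem symm : IsNode R y x where
  noetherian := h.noetherian
  maximalIdeal_eq := by rw [h.maximalIdeal_eq, Set.pair_comm]
  prime_x := h.prime_y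
  prime_y := h.prime_x
  x_notMem := h.y_notMem
  y_notMem := h.x_notMem
  mul_eq_zero := by rw [mul_comm, h.mul_eq_zero]

theorem mem_of_x_mul_mem {a : R} (ha : x * a ∈ Ideal.span {y}) : a ∈ Ideal.span {y} :=
  (h.prime_y.mem_or_mem ha).resolve_left h.x_notMem

theorem eq_zero_of_mem {a : R} (hx : a ∈ Ideal.span {x}) (hy : a ∈ Ideal.span {y}) : a = 0 := by
  obtain ⟨b, rfl⟩ := Ideal.mem_span_singleton'.mp hx
  rw [mul_comm] at hy
  obtain ⟨c, rfl⟩ := Ideal.mem_span_singleton'.mp (h.mem_of_x_mul_mem hy)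
  rw [mul_assoc, mul_comm y, h.mul_eq_zero, mul_zero]

theorem x_mul_eq_zero_iff {a : R} : x * a = 0 ↔ a ∈ Ideal.span {y} := by
  refine ⟨fun ha => h.mem_of_x_mul_mem (ha ▸ Ideal.zero_mem _), fun ha => ?_⟩
  obtain ⟨b, rfl⟩ := Ideal.mem_span_singleton'.mp ha
  rw [mul_left_comm, h.mul_eq_zero, mul_zero]

theorem x_mem : x ∈ IsLocalRing.maximalIdeal R := by
  rw [h.maximalIdeal_eq]; exact Ideal.subset_span (by simp)

theorem y_mem : y ∈ IsLocalRing.maximalIdeal R := h.symm.x_mem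

theorem add_mem : x + y ∈ IsLocalRing.maximalIdeal R := Ideal.add_mem _ h.x_mem h.y_mem

theorem exists_of_mem {r : R} (hr : r ∈ IsLocalRing.maximalIdeal R) :
    ∃ a b, r = a * x + b * y := by
  rw [h.maximalIdeal_eq] at hr
  obtain ⟨a, b, rfl⟩ := Ideal.mem_span_pair.mp hr
  exact ⟨a, b, rfl⟩

section Modules

variable {M : Type u} [AddCommGroup M] [Module R M]

theorem x_smul_y_smul (m : M) : x • y • m = 0 := by
  rw [smul_smul, h.mul_eq_zero, zero_smul]

theorem y_smul_x_smul (m : M) : y • x • m = 0 := h.symm.x_smul_y_smul m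

/-- A residually independent family in a module over the branch `R ⧸ (y)` is independent. -/
theorem mem_span_of_sum_eq_zero (hM : IsSMulRegular M (x + y)) (hy : ∀ m : M, y • m = 0)
    {ι : Type*} [Fintype ι] (v : ι → M)
    (hv : ∀ c : ι → R, (∃ m, ∑ i, c i • v i = x • m) → ∀ i, c i ∈ IsLocalRing.maximalIdeal R)
    (c : ι → R) (hc : ∑ i, c i • v i = 0) (i : ι) : c i ∈ Ideal.span {y} := by
  -- The coefficients of a relation lie in (x, y); as `y` kills `M` and `x` can be cancelled, the
  -- relation can be divided by `x` again and again. So each `c i` lies in (y) + (x^n) for all `n`,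
  -- and Krull's intersection theorem in R/(y) finishes.
  have key : ∀ n : ℕ, ∃ d : ι → R, ∑ i, d i • v i = 0 ∧
      ∀ i, c i - x ^ n * d i ∈ Ideal.span {y} := by
    intro n
    induction n with
    | zero => exact ⟨c, hc, fun i => by simp⟩
    | succ n ih =>
      obtain ⟨d, hd, hcd⟩ := ih
      have hm := hv d ⟨0, by rw [hd, smul_zero]⟩
      choose e f hef using fun i => h.exists_of_mem (hm i)
      refine ⟨e, eq_zero_of_smul hM ?_ (hy _), fun i => ?_⟩
      · rw [← hd, Finset.smul_sum]
        refine Finset.sum_congr rfl fun i _ => ?_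
        rw [hef i, add_smul, mul_smul (f i), hy, smul_zero, add_zero, smul_smul, mul_comm]
      · have : c i - x ^ (n + 1) * e i = (c i - x ^ n * d i) + (x ^ n * f i) * y := by
          rw [hef i]; ring
        rw [this]
        exact Ideal.add_mem _ (hcd i) (Ideal.mul_mem_left _ _ (Ideal.mem_span_singleton_self y))
  have := h.noetherian
  have hk := Ideal.iInf_pow_smul_eq_bot_of_isLocalRing (R := R) (M := R ⧸ Ideal.span {y})
    (IsLocalRing.maximalIdeal R) (Ideal.IsPrime.ne_top inferInstance)
  rw [← Ideal.Quotient.eq_zero_iff_mem, ← Submodule.mem_bot R, ← hk, Submodule.mem_iInf]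
  intro n
  obtain ⟨d, -, hd⟩ := key n
  have : Ideal.Quotient.mk (Ideal.span {y}) (c i) =
      x ^ n • Ideal.Quotient.mk (Ideal.span {y}) (d i) := by
    rw [← sub_eq_zero]
    exact Ideal.Quotient.eq_zero_iff_mem.mpr (hd i)
  rw [this]
  exact Submodule.smul_mem_smul (Ideal.pow_mem_pow h.x_mem n) trivial

/-- On the branch L = ker y, the elements x m_i stay independent modulo xL: if ∑ c_i x m_i = x l,
then ∑ c_i m_i - l is killed by x, so `hm` applies. Complete them to a basis of L/xL; Nakayama's
lemma makes the result generate L, and `mem_span_of_sum_eq_zero` makes it independent over R/(y). -/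
theorem exists_branch_basis [Module.Finite R M] (hM : IsSMulRegular M (x + y)) {a : ℕ}
    (m : Fin a → M)
    (hm : ∀ c : Fin a → R, ∑ i, c i • m i ∈ Submodule.torsionBy R M x ⊔ Submodule.torsionBy R M y →
      ∀ i, c i ∈ IsLocalRing.maximalIdeal R) :
    ∃ (b : ℕ) (n : Fin b → M), (∀ j, y • n j = 0) ∧
      Submodule.torsionBy R M y ≤
        Submodule.span R (Set.range fun i => x • m i) ⊔ Submodule.span R (Set.range n) ∧
      ∀ (r : Fin a → R) (s : Fin b → R), ∑ i, r i • x • m i + ∑ j, s j • n j = 0 →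
        (∀ i, r i ∈ Ideal.span {y}) ∧ ∀ j, s j ∈ Ideal.span {y} := by
  have := h.noetherian
  let L := Submodule.torsionBy R M y
  have hyL : ∀ l : L, y • l = 0 := fun l => Subtype.ext l.2
  have hL : IsSMulRegular L (x + y) := hM.submodule L _
  let U : Submodule R L := LinearMap.range (LinearMap.lsmul R L x)
  let v : Fin a → L := fun i => ⟨x • m i, h.y_smul_x_smul _⟩
  have hU : ∀ r ∈ IsLocalRing.maximalIdeal R, ∀ l : L, r • l ∈ U := by
    intro r hr l
    obtain ⟨c, d, rfl⟩ := h.exists_of_mem hr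
    refine ⟨c • l, ?_⟩
    rw [LinearMap.lsmul_apply, add_smul, mul_smul d, hyL, smul_zero, add_zero, smul_smul, mul_comm]
  obtain ⟨b, w, hspan, hw⟩ := exists_residue_extension U hU v (fun c hc => hm c (by
    obtain ⟨l, hl⟩ := hc
    have hl' : x • (l : M) = ∑ i, c i • x • m i := by
      simpa [v] using congrArg (Subtype.val) hl
    rw [← sub_add_cancel (∑ i, c i • m i) (l : M)]
    refine Submodule.add_mem_sup ?_ l.2
    rw [Submodule.mem_torsionBy_iff, smul_sub, hl', Finset.smul_sum, sub_eq_zero]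
    exact Finset.sum_congr rfl fun i _ => smul_comm _ _ _))
  have htop : Submodule.span R (Set.range v) ⊔ Submodule.span R (Set.range w) = ⊤ := by
    refine top_le_iff.mp (Submodule.le_of_le_smul_of_le_jacobson_bot (I := IsLocalRing.maximalIdeal R)
      Module.Finite.fg_top (IsLocalRing.maximalIdeal_le_jacobson _) ?_)
    rw [← hspan]
    refine sup_le_sup_left ?_ _
    rintro _ ⟨l, rfl⟩
    rw [hspan]
    exact Submodule.smul_mem_smul h.x_mem trivial
  refine ⟨b, fun j => w j, fun j => (w j).2, ?_, fun r s hrs => ?_⟩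
  · have := congrArg (Submodule.map L.subtype) htop
    rw [Submodule.map_sup, Submodule.map_span, Submodule.map_span, Submodule.map_top,
      Submodule.range_subtype, ← Set.range_comp, ← Set.range_comp] at this
    exact this.ge
  · have key := h.mem_span_of_sum_eq_zero hL hyL (Sum.elim v w) (fun c hc i => by
      obtain ⟨l, hl⟩ := hc
      rw [Fintype.sum_sum_type] at hl
      have := hw (fun i => c (Sum.inl i)) (fun j => c (Sum.inr j)) ⟨l, hl.symm⟩
      cases i with
      | inl i => exact this.1 i
      | inr j => exact this.2 j) (Sum.elim r s) (by
        rw [Fintype.sum_sum_type]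
        apply Subtype.ext
        simpa [v] using hrs)
    exact ⟨fun i => key (Sum.inl i), fun j => key (Sum.inr j)⟩

/-- The classification of finitely generated torsion-free modules over a node. -/
theorem exists_equiv [Module.Finite R M] (hM : IsSMulRegular M (x + y)) :
    ∃ a b c : ℕ, Nonempty (((Fin a → R) × (Fin b → R ⧸ Ideal.span {x}) ×
      (Fin c → R ⧸ Ideal.span {y})) ≃ₗ[R] M) := by
  -- `U` contains 𝔪M, because xM ⊆ ker y and yM ⊆ ker x. A basis `m` of `M ⧸ U` will span the free
  -- part, while `q` and `p` complete x m and y m to bases of ker y and ker x.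
  let U := Submodule.torsionBy R M x ⊔ Submodule.torsionBy R M y
  obtain ⟨a, m, hspan, hm⟩ := exists_residue_extension U (fun r hr l => by
    obtain ⟨c, d, rfl⟩ := h.exists_of_mem hr
    rw [add_comm, add_smul, mul_comm, mul_smul, mul_comm, mul_smul]
    exact Submodule.add_mem_sup (h.x_smul_y_smul _) (h.y_smul_x_smul _)) (Fin.elim0 : Fin 0 → M)
    (fun _ _ i => i.elim0)
  have hm : ∀ c : Fin a → R, ∑ i, c i • m i ∈ U → ∀ i, c i ∈ IsLocalRing.maximalIdeal R :=
    fun c hc => (hm Fin.elim0 c (by simpa using hc)).2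
  obtain ⟨c, q, hq, hqs, hqi⟩ := h.exists_branch_basis hM m hm
  obtain ⟨b, p, hp, hps, hpi⟩ := h.symm.exists_branch_basis (add_comm x y ▸ hM) m
    (by rwa [sup_comm])
  let f : ((Fin a → R) × (Fin b → R ⧸ Ideal.span {x}) × (Fin c → R ⧸ Ideal.span {y})) →ₗ[R] M :=
    (Fintype.linearCombination R m).coprod ((quotHom x p hp).coprod (quotHom y q hq))
  have hf : ∀ (r : Fin a → R) (s : Fin b → R) (u : Fin c → R),
      f (r, (fun i => Ideal.Quotient.mk _ (s i)), fun i => Ideal.Quotient.mk _ (u i)) =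
        ∑ i, r i • m i + (∑ i, s i • p i + ∑ i, u i • q i) := by
    intro r s u
    simp only [f, LinearMap.coprod_apply, quotHom_mk, Fintype.linearCombination_apply]
  refine ⟨a, b, c, ⟨LinearEquiv.ofBijective f ⟨?_, ?_⟩⟩⟩
  · rw [injective_iff_map_eq_zero]
    rintro ⟨r, s, u⟩ h0
    obtain ⟨s, rfl⟩ := exists_eq_mk s
    obtain ⟨u, rfl⟩ := exists_eq_mk u
    rw [hf] at h0
    -- Multiplying the relation by `x` kills the `p` terms and leaves a relation in ker y, so `r i`
    -- lies in (y). Multiplying by `y` puts it in (x) too, and (x) ∩ (y) = 0.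
    have h1 := hqi r (fun j => x * u j) (by
      rw [← smul_zero x, ← h0, smul_add, smul_add, Finset.smul_sum, Finset.smul_sum,
        Finset.smul_sum]
      have : ∑ i, x • s i • p i = 0 := Finset.sum_eq_zero fun i _ => by
        rw [smul_comm, hp, smul_zero]
      rw [this, zero_add]
      congr 1
      · exact Finset.sum_congr rfl fun i _ => smul_comm _ _ _
      · exact Finset.sum_congr rfl fun i _ => mul_smul _ _ _)
    have h2 := hpi r (fun j => y * s j) (by
      rw [← smul_zero y, ← h0, smul_add, smul_add, Finset.smul_sum, Finset.smul_sum,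
        Finset.smul_sum]
      have : ∑ i, y • u i • q i = 0 := Finset.sum_eq_zero fun i _ => by
        rw [smul_comm, hq, smul_zero]
      rw [this, add_zero]
      congr 1
      · exact Finset.sum_congr rfl fun i _ => smul_comm _ _ _
      · exact Finset.sum_congr rfl fun i _ => mul_smul _ _ _)
    refine Prod.ext (funext fun i => h.eq_zero_of_mem (h2.1 i) (h1.1 i)) (Prod.ext ?_ ?_)
    · exact funext fun i => Ideal.Quotient.eq_zero_iff_mem.mpr (h.symm.mem_of_x_mul_mem (h2.2 i))
    · exact funext fun i => Ideal.Quotient.eq_zero_iff_mem.mpr (h.mem_of_x_mul_mem (h1.2 i))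
  · have hmf : ∀ i, m i ∈ LinearMap.range f := fun i =>
      ⟨(Pi.single i 1, 0, 0), by simp [f]⟩
    have hpf : ∀ i, p i ∈ LinearMap.range f := fun i =>
      ⟨_, (hf 0 (Pi.single i 1) 0).trans (by simp [Pi.single_apply])⟩
    have hqf : ∀ i, q i ∈ LinearMap.range f := fun i =>
      ⟨_, (hf 0 0 (Pi.single i 1)).trans (by simp [Pi.single_apply])⟩
    rw [← LinearMap.range_eq_top, ← top_le_iff, ← hspan]
    refine sup_le (sup_le (Submodule.span_le.mpr ?_) (Submodule.span_le.mpr ?_)) (sup_le ?_ ?_)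
    · rintro _ ⟨i, -⟩; exact i.elim0
    · rintro _ ⟨i, rfl⟩; exact hmf i
    · refine hps.trans (sup_le (Submodule.span_le.mpr ?_) (Submodule.span_le.mpr ?_))
      · rintro _ ⟨i, rfl⟩; exact Submodule.smul_mem _ _ (hmf i)
      · rintro _ ⟨i, rfl⟩; exact hpf i
    · refine hqs.trans (sup_le (Submodule.span_le.mpr ?_) (Submodule.span_le.mpr ?_))
      · rintro _ ⟨i, rfl⟩; exact Submodule.smul_mem _ _ (hmf i)
      · rintro _ ⟨i, rfl⟩; exact hqf i

end Modules

end IsNode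

/-! ### Direct summands -/

theorem IsDirectSummand.trans {R : Type u} [CommRing R] {X M N : Type u} [AddCommGroup X]
    [Module R X] [AddCommGroup M] [Module R M] [AddCommGroup N] [Module R N]
    (h : IsDirectSummand R X M) (h' : IsDirectSummand R M N) : IsDirectSummand R X N := by
  obtain ⟨i, p, hip⟩ := h
  obtain ⟨j, q, hjq⟩ := h'
  refine ⟨j ∘ₗ i, p ∘ₗ q, LinearMap.ext fun m => ?_⟩
  exact (congrArg p (LinearMap.congr_fun hjq (i m))).trans (LinearMap.congr_fun hip m)

theorem IsDirectSummand.of_equiv {R : Type u} [CommRing R] {X M : Type u} [AddCommGroup X]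
    [Module R X] [AddCommGroup M] [Module R M] (e : X ≃ₗ[R] M) : IsDirectSummand R X M :=
  ⟨e, e.symm, by ext; simp⟩

theorem IsDirectSummand.fst (R : Type u) [CommRing R] (X M : Type u) [AddCommGroup X]
    [Module R X] [AddCommGroup M] [Module R M] : IsDirectSummand R X (X × M) :=
  ⟨LinearMap.inl R X M, LinearMap.fst R X M, by ext; simp⟩

theorem IsDirectSummand.snd (R : Type u) [CommRing R] (X M : Type u) [AddCommGroup X]
    [Module R X] [AddCommGroup M] [Module R M] : IsDirectSummand R M (X × M) :=
  ⟨LinearMap.inr R X M, LinearMap.snd R X M, by ext; simp⟩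

theorem IsDirectSummand.pi (R : Type u) [CommRing R] (X : Type u) [AddCommGroup X]
    [Module R X] {a : ℕ} (i : Fin a) : IsDirectSummand R X (Fin a → X) :=
  ⟨LinearMap.single R (fun _ => X) i, LinearMap.proj i, by ext; simp⟩

theorem IsDirectSummand.isSMulRegular {R : Type u} [CommRing R] {X M : Type u} [AddCommGroup X]
    [Module R X] [AddCommGroup M] [Module R M] (h : IsDirectSummand R X M) {t : R}
    (hM : IsSMulRegular M t) : IsSMulRegular X t := by
  obtain ⟨i, p, hip⟩ := h
  exact hM.of_injective i (Function.LeftInverse.injective (LinearMap.congr_fun hip))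

theorem IsDirectSummand.finite {R : Type u} [CommRing R] {X M : Type u} [AddCommGroup X]
    [Module R X] [AddCommGroup M] [Module R M] (h : IsDirectSummand R X M) [Module.Finite R M] :
    Module.Finite R X := by
  obtain ⟨i, p, hip⟩ := h
  exact Module.Finite.of_surjective p (Function.RightInverse.surjective (LinearMap.congr_fun hip))

theorem isSMulRegular_prod {R : Type u} [CommRing R] {X Y : Type u} [AddCommGroup X] [Module R X]
    [AddCommGroup Y] [Module R Y] {t : R} (hX : IsSMulRegular X t) (hY : IsSMulRegular Y t) :
    IsSMulRegular (X × Y) t := fun _ _ hab =>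
  Prod.ext (hX (congrArg Prod.fst hab)) (hY (congrArg Prod.snd hab))

/-! ### Dimension, depth and the criterion for MCM modules -/

namespace IsNode

variable {R : Type u} [CommRing R] [IsLocalRing R] {x y : R} (h : IsNode R x y)
include h

theorem isSMulRegular_self : IsSMulRegular R (x + y) := by
  refine isSMulRegular_iff_right_eq_zero_of_smul.mpr fun a ha => ?_
  rw [smul_eq_mul, add_mul] at ha
  have h1 : x * a = 0 := h.eq_zero_of_mem (Ideal.mul_mem_right _ _ (Ideal.mem_span_singleton_self x))
    (by rw [eq_neg_of_add_eq_zero_left ha]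
        exact neg_mem (Ideal.mul_mem_right _ _ (Ideal.mem_span_singleton_self y)))
  rw [h1, zero_add] at ha
  exact h.eq_zero_of_mem (h.symm.x_mul_eq_zero_iff.mp ha) (h.x_mul_eq_zero_iff.mp h1)

theorem isSMulRegular_quotient : IsSMulRegular (R ⧸ Ideal.span {x}) (x + y) := by
  refine isSMulRegular_iff_right_eq_zero_of_smul.mpr fun a ha => ?_
  obtain ⟨a, rfl⟩ := Ideal.Quotient.mk_surjective a
  have ha' : (x + y) * a ∈ Ideal.span {x} := Ideal.Quotient.eq_zero_iff_mem.mp ha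
  rw [add_mul] at ha'
  exact Ideal.Quotient.eq_zero_iff_mem.mpr (h.symm.mem_of_x_mul_mem
    ((Ideal.add_mem_iff_right _ (Ideal.mul_mem_right _ _ (Ideal.mem_span_singleton_self x))).mp ha'))

theorem isSMulRegular_quotient' : IsSMulRegular (R ⧸ Ideal.span {y}) (x + y) := by
  rw [add_comm]; exact h.symm.isSMulRegular_quotient

theorem nontrivial_quotient : Nontrivial (R ⧸ Ideal.span {x}) :=
  Ideal.Quotient.nontrivial_iff.mpr h.prime_x.ne_top

/-- The maximal ideal is minimal over (x + y), since x² = x(x + y), so Krull's principal ideal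
theorem bounds the dimension by 1. Regularity of x + y gives the other inequality. -/
theorem ringKrullDim_eq_one : ringKrullDim R = 1 := by
  have := h.noetherian
  apply le_antisymm
  · rw [← IsLocalRing.maximalIdeal_height_eq_ringKrullDim]
    refine WithBot.coe_le_coe.mpr
      (Ideal.height_le_one_of_isPrincipal_of_mem_minimalPrimes (Ideal.span {x + y}) _ ?_)
    refine ⟨⟨inferInstance, (Ideal.span_singleton_le_iff_mem _).mpr h.add_mem⟩, ?_⟩
    rintro p ⟨hp, hle⟩ -
    have ht := hle (Ideal.mem_span_singleton_self _)
    have hx : x ∈ p := hp.mem_of_pow_mem 2 (by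
      have : x ^ 2 = x * (x + y) := by rw [mul_add, h.mul_eq_zero]; ring
      rw [this]; exact Ideal.mul_mem_left _ _ ht)
    have hy : y ∈ p := (Ideal.add_mem_iff_right _ hx).mp ht
    rw [h.maximalIdeal_eq, Ideal.span_le]
    rintro _ (rfl | rfl)
    exacts [hx, hy]
  · rw [← ringKrullDim_quotient_span_singleton_succ_eq_ringKrullDim h.isSMulRegular_self h.add_mem]
    have : Nontrivial (R ⧸ Ideal.span {x + y}) := Ideal.Quotient.nontrivial_iff.mpr fun h1 =>
      (IsLocalRing.maximalIdeal.isMaximal R).ne_top (top_le_iff.mp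
        (h1 ▸ (Ideal.span_singleton_le_iff_mem _).mpr h.add_mem))
    exact le_add_of_nonneg_left ringKrullDim_nonneg_of_nontrivial

variable {M : Type u} [AddCommGroup M] [Module R M]

/-- For r = ax + by one has r² = (a²x + b²y)(x + y), as xy = 0. Hence x + y is a universal test
element for positive depth. -/
theorem isSMulRegular_add_of_mem {r : R} (hr : r ∈ IsLocalRing.maximalIdeal R)
    (hM : IsSMulRegular M r) : IsSMulRegular M (x + y) := by
  refine isSMulRegular_iff_right_eq_zero_of_smul.mpr fun m hm => ?_
  obtain ⟨a, b, rfl⟩ := h.exists_of_mem hr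
  have hM := isSMulRegular_iff_right_eq_zero_of_smul.mp hM
  have h0 : (a * x + b * y) * (a * x + b * y) = (a * a * x + b * b * y) * (x + y) := by
    linear_combination (2 * a * b - a * a - b * b) * h.mul_eq_zero
  exact hM _ (hM _ (by rw [smul_smul, h0, mul_smul, hm, smul_zero]))

theorem depth_eq_one [Nontrivial M] [Module.Finite R M] (hM : IsSMulRegular M (x + y)) :
    depth R M = 1 := by
  have := h.noetherian
  apply le_antisymm
  · refine iSup₂_le fun rs hrs => ?_
    have h1 := Module.supportDim_add_length_eq_supportDim_of_isRegular rs hrs.2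
    have h2 := Module.supportDim_le_ringKrullDim R M
    rw [← h1, h.ringKrullDim_eq_one] at h2
    have : Nontrivial (M ⧸ Ideal.ofList rs • (⊤ : Submodule R M)) :=
      Submodule.Quotient.nontrivial_iff.mpr hrs.2.top_ne_smul.symm
    have h3 : (0 : WithBot ℕ∞) ≤ Module.supportDim R (M ⧸ Ideal.ofList rs • (⊤ : Submodule R M)) := by
      rw [Module.supportDim_eq_ringKrullDim_quotient_annihilator]
      have : Nontrivial (R ⧸ Module.annihilator R (M ⧸ Ideal.ofList rs • (⊤ : Submodule R M))) :=
        Ideal.Quotient.nontrivial_iff.mpr fun h4 => by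
          rw [Module.annihilator_eq_top_iff] at h4
          exact not_subsingleton _ h4
      exact ringKrullDim_nonneg_of_nontrivial
    have h4 := (le_add_of_nonneg_left h3).trans h2
    exact_mod_cast h4
  · have hreg : RingTheory.Sequence.IsRegular M [x + y] := by
      rw [IsLocalRing.isRegular_iff_isWeaklyRegular_of_subset_maximalIdeal]
      · exact .cons hM (.nil _ _)
      · simpa using h.add_mem
    refine le_iSup₂_of_le [x + y] ⟨by simpa using h.add_mem, hreg⟩ (by simp)

theorem isMCM_iff : IsMCM R M ↔ Module.Finite R M ∧ IsSMulRegular M (x + y) := by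
  constructor
  · rintro ⟨hfin, hM | hM⟩
    · exact ⟨hfin, fun a b _ => Subsingleton.elim a b⟩
    · refine ⟨hfin, ?_⟩
      by_contra hcon
      have h0 : depth R M = 0 := by
        refine le_antisymm (iSup₂_le fun rs hrs => ?_) zero_le
        cases rs with
        | nil => simp
        | cons r rs =>
          rw [RingTheory.Sequence.isRegular_cons_iff] at hrs
          exact (hcon (h.isSMulRegular_add_of_mem (hrs.1 r (by simp)) hrs.2.1)).elim
      rw [h0, h.ringKrullDim_eq_one] at hM
      exact absurd hM (by simp)
  · rintro ⟨hfin, hM⟩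
    refine ⟨hfin, ?_⟩
    rcases subsingleton_or_nontrivial M with hs | hn
    · exact Or.inl hs
    · right
      rw [h.depth_eq_one hM, h.ringKrullDim_eq_one]
      rfl

end IsNode

/-! ### Right modules Hom_R(M, X) over End_R(M) -/

section Splitting

variable {A : Type u} [Ring A] {X Y Z : Type u} [AddCommGroup X] [Module A X] [AddCommGroup Y]
  [Module A Y] [AddCommGroup Z] [Module A Z]

theorem exists_retraction_of_projective [Module.Projective A Z] {f : X →ₗ[A] Y} {g : Y →ₗ[A] Z}
    (hf : Function.Injective f) (hfg : Function.Exact f g) (hg : Function.Surjective g) :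
    ∃ ρ : Y →ₗ[A] X, ∀ a, ρ (f a) = a := by
  obtain ⟨s, hs⟩ := Module.projective_lifting_property g LinearMap.id hg
  have hl : (∃ l, g ∘ₗ l = LinearMap.id) ↔ ∃ l, l ∘ₗ f = LinearMap.id :=
    (hfg.split_tfae hf hg).out 0 1
  obtain ⟨ρ, hρ⟩ := hl.mp ⟨s, hs⟩
  exact ⟨ρ, LinearMap.congr_fun hρ⟩

theorem hasProjectiveDimensionLT_of_equiv (e : X ≃ₗ[A] Y) {n : ℕ}
    (h : HasProjectiveDimensionLT (ModuleCat.of A X) n) :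
    HasProjectiveDimensionLT (ModuleCat.of A Y) n :=
  hasProjectiveDimensionLT_of_iso e.toModuleIso n

theorem exact_subtype_ker (g : Y →ₗ[A] Z) :
    Function.Exact (LinearMap.ker g).subtype g := fun b => by simp

end Splitting

section RightModules

variable {R : Type u} [CommRing R] {M : Type u} [AddCommGroup M] [Module R M]
  {X Y Z : Type u} [AddCommGroup X] [Module R X] [AddCommGroup Y] [Module R Y] [AddCommGroup Z]
  [Module R Z]

/-- `Hom_R(M, X)` is a right module over `End_R(M)`. -/
instance homRightModule : Module (Module.End R M)ᵐᵒᵖ (M →ₗ[R] X) where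
  smul a f := f ∘ₗ a.unop
  one_smul _ := rfl
  mul_smul _ _ _ := rfl
  smul_zero _ := LinearMap.zero_comp _
  smul_add _ _ _ := LinearMap.add_comp _ _ _
  add_smul _ _ _ := LinearMap.comp_add _ _ _
  zero_smul _ := LinearMap.comp_zero _

theorem op_smul_hom (a : (Module.End R M)ᵐᵒᵖ) (f : M →ₗ[R] X) : a • f = f ∘ₗ a.unop := rfl

instance : IsScalarTower R (Module.End R M)ᵐᵒᵖ (M →ₗ[R] X) where
  smul_assoc r a f := by
    rw [op_smul_hom, op_smul_hom, MulOpposite.unop_smul, LinearMap.comp_smul]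

variable (M) in
/-- Postcomposition as a map of right modules over `End_R(M)`. -/
def postcomp (φ : X →ₗ[R] Y) : (M →ₗ[R] X) →ₗ[(Module.End R M)ᵐᵒᵖ] (M →ₗ[R] Y) where
  toFun f := φ ∘ₗ f
  map_add' _ _ := LinearMap.comp_add _ _ _
  map_smul' _ _ := rfl

@[simp]
theorem postcomp_apply (φ : X →ₗ[R] Y) (f : M →ₗ[R] X) : postcomp M φ f = φ ∘ₗ f := rfl

theorem postcomp_injective {φ : X →ₗ[R] Y} (hφ : Function.Injective φ) :
    Function.Injective (postcomp M φ) := fun _ _ hfg =>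
  LinearMap.ext fun m => hφ (LinearMap.congr_fun hfg m)

theorem postcomp_exact {i : X →ₗ[R] Y} {p : Y →ₗ[R] Z} (hi : Function.Injective i)
    (hip : Function.Exact i p) : Function.Exact (postcomp M i) (postcomp M p) := by
  intro f
  constructor
  · intro hf
    have hf' : ∀ m, f m ∈ LinearMap.range i := fun m => (hip _).mp (LinearMap.congr_fun hf m)
    refine ⟨(LinearEquiv.ofInjective i hi).symm ∘ₗ f.codRestrict _ hf', LinearMap.ext fun m => ?_⟩
    exact congrArg Subtype.val
      ((LinearEquiv.ofInjective i hi).apply_symm_apply (f.codRestrict _ hf' m))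
  · rintro ⟨g, rfl⟩
    exact LinearMap.ext fun m => (hip _).mpr ⟨g m, rfl⟩

theorem postcomp_rangeRestrict_exact {i : X →ₗ[R] Y} {p : Y →ₗ[R] Z} (hi : Function.Injective i)
    (hip : Function.Exact i p) :
    Function.Exact (postcomp M i) (postcomp M p).rangeRestrict := fun f => by
  rw [← postcomp_exact hi hip f, Subtype.ext_iff]
  rfl

/-- Hom(M, -) sends M^n to a free right module of rank n and preserves retracts. -/
theorem InAdd.projective_hom (h : InAdd R M X) :
    Module.Projective (Module.End R M)ᵐᵒᵖ (M →ₗ[R] X) := by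
  obtain ⟨n, i, p, hip⟩ := h
  let s : (M →ₗ[R] X) →ₗ[(Module.End R M)ᵐᵒᵖ] (Fin n → (Module.End R M)ᵐᵒᵖ) :=
    { toFun f j := MulOpposite.op (LinearMap.proj j ∘ₗ i ∘ₗ f)
      map_add' f g := by
        ext1 j
        simp only [LinearMap.comp_add, Pi.add_apply, MulOpposite.op_add]
      map_smul' _ _ := rfl }
  let π : (Fin n → (Module.End R M)ᵐᵒᵖ) →ₗ[(Module.End R M)ᵐᵒᵖ] (M →ₗ[R] X) :=
    { toFun a := ∑ j, (p ∘ₗ LinearMap.single R (fun _ => M) j) ∘ₗ (a j).unop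
      map_add' a b := by
        simp only [Pi.add_apply, MulOpposite.unop_add, LinearMap.comp_add, Finset.sum_add_distrib]
      map_smul' a b := by
        ext m
        simp [op_smul_hom] }
  refine Module.Projective.of_split s π (LinearMap.ext fun f => LinearMap.ext fun m => ?_)
  have h1 : (π ∘ₗ s) f m = p (∑ j, Pi.single j (i (f m) j)) := by
    simp [π, s]
  rw [h1, Finset.univ_sum_single]
  exact LinearMap.congr_fun hip (f m)

theorem IsDirectSummand.inAdd (h : IsDirectSummand R X M) : InAdd R M X :=
  ⟨1, h.trans (.pi R M 0)⟩

theorem inAdd_self : InAdd R M M := (IsDirectSummand.of_equiv (.refl R M)).inAdd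

theorem inAdd_pi_self (n : ℕ) : InAdd R M (Fin n → M) := ⟨n, .of_equiv (.refl R _)⟩

/-- Every map from `M` lifts along `p`. -/
def Lifts (M : Type u) [AddCommGroup M] [Module R M] (p : Y →ₗ[R] Z) : Prop :=
  ∀ f : M →ₗ[R] Z, ∃ g : M →ₗ[R] Y, p ∘ₗ g = f

/-- Lifting keeps Hom(M, -) exact on the right, so Hom(M, X) is a first syzygy of Hom(M, Z). -/
theorem hasProjectiveDimensionLT_hom_iff {i : X →ₗ[R] Y} {p : Y →ₗ[R] Z}
    (hi : Function.Injective i) (hip : Function.Exact i p) (hp : Lifts M p) (hY : InAdd R M Y)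
    (n : ℕ) :
    HasProjectiveDimensionLT (ModuleCat.of (Module.End R M)ᵐᵒᵖ (M →ₗ[R] Z)) (n + 2) ↔
      HasProjectiveDimensionLT (ModuleCat.of (Module.End R M)ᵐᵒᵖ (M →ₗ[R] X)) (n + 1) :=
  have := hY.projective_hom
  hasProjectiveDimensionLT_iff_of_exact (postcomp_injective hi) (postcomp_exact hi hip) hp n

/-- Without lifting, the same syzygy argument still works for the image of Hom(M, Y) in Hom(M, Z).
-/
theorem hasProjectiveDimensionLT_range_iff {i : X →ₗ[R] Y} {p : Y →ₗ[R] Z}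
    (hi : Function.Injective i) (hip : Function.Exact i p) (hY : InAdd R M Y) (n : ℕ) :
    HasProjectiveDimensionLT
        (ModuleCat.of (Module.End R M)ᵐᵒᵖ (LinearMap.range (postcomp M p))) (n + 2) ↔
      HasProjectiveDimensionLT (ModuleCat.of (Module.End R M)ᵐᵒᵖ (M →ₗ[R] X)) (n + 1) :=
  have := hY.projective_hom
  hasProjectiveDimensionLT_iff_of_exact (postcomp_injective hi)
    (postcomp_rangeRestrict_exact hi hip) (LinearMap.surjective_rangeRestrict _) n

theorem hasProjectiveDimensionLT_quotient_iff (hZ : InAdd R M Z)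
    (J : Submodule (Module.End R M)ᵐᵒᵖ (M →ₗ[R] Z)) (n : ℕ) :
    HasProjectiveDimensionLT
        (ModuleCat.of (Module.End R M)ᵐᵒᵖ ((M →ₗ[R] Z) ⧸ J)) (n + 2) ↔
      HasProjectiveDimensionLT (ModuleCat.of (Module.End R M)ᵐᵒᵖ J) (n + 1) :=
  have := hZ.projective_hom
  hasProjectiveDimensionLT_iff_of_exact J.injective_subtype (LinearMap.exact_subtype_mkQ J)
    J.mkQ_surjective n

/-- A right ideal of the endomorphism ring is finitely generated, since `M →ₗ[R] M` is Noetherian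
over `R`; its generators are the components of `G`. -/
theorem exists_eq_range_postcomp [IsNoetherianRing R] [Module.Finite R M]
    (J : Submodule (Module.End R M)ᵐᵒᵖ (M →ₗ[R] M)) :
    ∃ (n : ℕ) (G : (Fin n → M) →ₗ[R] M), J = LinearMap.range (postcomp M G) := by
  have : IsNoetherian R (M →ₗ[R] M) := inferInstance
  have : IsNoetherian (Module.End R M)ᵐᵒᵖ (M →ₗ[R] M) := isNoetherian_of_tower R this
  obtain ⟨n, g, hg⟩ := Submodule.fg_iff_exists_fin_generating_family.mp
    (IsNoetherian.noetherian J)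
  refine ⟨n, ∑ j, g j ∘ₗ LinearMap.proj j, le_antisymm ?_ ?_⟩
  · rw [← hg, Submodule.span_le]
    rintro _ ⟨j, rfl⟩
    refine ⟨LinearMap.single R (fun _ => M) j, LinearMap.ext fun m => ?_⟩
    simp only [postcomp_apply, LinearMap.comp_apply, LinearMap.sum_apply, LinearMap.proj_apply,
      LinearMap.coe_single]
    rw [Finset.sum_eq_single j (fun k _ hk => by simp [hk]) (by simp)]
    simp
  · rintro _ ⟨f, rfl⟩
    have hsum : postcomp M (∑ j, g j ∘ₗ LinearMap.proj j) f =
        ∑ j, (g j ∘ₗ LinearMap.proj j) ∘ₗ f := by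
      ext m
      simp
    rw [hsum]
    refine Submodule.sum_mem _ fun j _ => ?_
    exact J.smul_mem (MulOpposite.op (LinearMap.proj j ∘ₗ f : Module.End R M))
      (hg.le (Submodule.subset_span (Set.mem_range_self j)))

theorem globalDimEnd_le_of_range [IsNoetherianRing R] [Module.Finite R M] (n : ℕ)
    (h : ∀ (m : ℕ) (G : (Fin m → M) →ₗ[R] M), HasProjectiveDimensionLT
      (ModuleCat.of (Module.End R M)ᵐᵒᵖ (LinearMap.range (postcomp M G))) (n + 1)) :
    globalDimEnd R M ≤ ((n + 1 : ℕ) : WithBot ℕ∞) := by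
  refine globalDim_le_of_quotient (n + 1) fun J => ?_
  let e : (Module.End R M)ᵐᵒᵖ ≃ₗ[(Module.End R M)ᵐᵒᵖ] (M →ₗ[R] M) :=
    { MulOpposite.opAddEquiv.symm with map_smul' := fun _ _ => rfl }
  obtain ⟨m, G, hG⟩ := exists_eq_range_postcomp (J.map (e : _ →ₗ[(Module.End R M)ᵐᵒᵖ] _))
  refine hasProjectiveDimensionLT_of_equiv (Submodule.Quotient.equiv J _ e rfl).symm ?_
  rw [hG]
  exact (hasProjectiveDimensionLT_quotient_iff inAdd_self _ n).mpr (h m G)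

theorem globalDimEnd_le_of_ker [IsNoetherianRing R] [Module.Finite R M] (n : ℕ)
    (h : ∀ (m : ℕ) (G : (Fin m → M) →ₗ[R] M), HasProjectiveDimensionLT
      (ModuleCat.of (Module.End R M)ᵐᵒᵖ (M →ₗ[R] LinearMap.ker G)) (n + 1)) :
    globalDimEnd R M ≤ ((n + 2 : ℕ) : WithBot ℕ∞) :=
  globalDimEnd_le_of_range (n + 1) fun m G =>
    (hasProjectiveDimensionLT_range_iff (LinearMap.ker G).injective_subtype
      (exact_subtype_ker G) (inAdd_pi_self m) n).mpr (h m G)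

/-- Composing with a section of `G` splits Hom(M, M^m) onto the corresponding right ideal, so all
right ideals are projective. -/
theorem globalDimEnd_le_one [IsNoetherianRing R] [Module.Finite R M]
    (h : ∀ (m : ℕ) (G : (Fin m → M) →ₗ[R] M), ∃ σ : LinearMap.range G →ₗ[R] (Fin m → M),
      ∀ l, G (σ l) = l) : globalDimEnd R M ≤ ((1 : ℕ) : WithBot ℕ∞) := by
  refine globalDimEnd_le_of_range 0 fun m G => hasProjectiveDimensionLT_one_iff.mpr ?_
  obtain ⟨σ, hσ⟩ := h m G
  have := (inAdd_pi_self (R := R) (M := M) m).projective_hom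
  have hr : ∀ (f : LinearMap.range (postcomp M G)) (a : M), f.1 a ∈ LinearMap.range G := by
    rintro ⟨_, f, rfl⟩ a
    exact ⟨f a, rfl⟩
  let s : LinearMap.range (postcomp M G) →ₗ[(Module.End R M)ᵐᵒᵖ] (M →ₗ[R] (Fin m → M)) :=
    { toFun f := σ ∘ₗ f.1.codRestrict _ (hr f)
      map_add' f g := by
        ext1 a
        exact map_add σ ⟨f.1 a, hr f a⟩ ⟨g.1 a, hr g a⟩
      map_smul' _ _ := rfl }
  exact Module.Projective.of_split s (postcomp M G).rangeRestrict
    (LinearMap.ext fun f => Subtype.ext (LinearMap.ext fun a => hσ ⟨f.1 a, hr f a⟩))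

theorem one_le_globalDimEnd [IsLocalRing R] [Module.Finite R M] [Nontrivial M] {t : R}
    (ht : t ∈ IsLocalRing.maximalIdeal R) (hM : IsSMulRegular M t) :
    ((1 : ℕ) : WithBot ℕ∞) ≤ globalDimEnd R M := by
  let φ : M →ₗ[R] M := LinearMap.lsmul R M t
  let J := LinearMap.range (postcomp M φ)
  refine le_globalDim_of_not_hasProjectiveDimensionLT (X := (M →ₗ[R] M) ⧸ J) 1 fun hJ => ?_
  have := hasProjectiveDimensionLT_one_iff.mp hJ
  obtain ⟨ρ, hρ⟩ := exists_retraction_of_projective (postcomp_injective (M := M) (φ := φ) hM)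
    (LinearMap.exact_map_mkQ_range (postcomp M φ)) J.mkQ_surjective
  -- By right linearity ρ(id) ∘ φ = ρ(φ ∘ id) = id. Thus multiplication by `t` is onto, against
  -- Nakayama's lemma.
  have h1 : ρ LinearMap.id ∘ₗ φ = LinearMap.id := by
    refine Eq.trans ?_ (hρ LinearMap.id)
    exact (map_smul ρ (MulOpposite.op (φ : Module.End R M)) LinearMap.id).symm
  have htop : (⊤ : Submodule R M) ≤ IsLocalRing.maximalIdeal R • ⊤ := fun m _ => by
    have h2 : t • ρ LinearMap.id m = m := by
      rw [← map_smul]; exact LinearMap.congr_fun h1 m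
    rw [← h2]
    exact Submodule.smul_mem_smul ht trivial
  have := Submodule.eq_bot_of_le_smul_of_le_jacobson_bot _ _ Module.Finite.fg_top htop
    (IsLocalRing.maximalIdeal_le_jacobson _)
  exact bot_ne_top this.symm

end RightModules

/-! ### Closure properties of add M -/

section InAdd

variable {R : Type u} [CommRing R] {M : Type u} [AddCommGroup M] [Module R M]
  {X Y Z : Type u} [AddCommGroup X] [Module R X] [AddCommGroup Y] [Module R Y] [AddCommGroup Z]
  [Module R Z]

theorem IsDirectSummand.prodMap {X' Y' : Type u} [AddCommGroup X'] [Module R X'] [AddCommGroup Y']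
    [Module R Y'] (hX : IsDirectSummand R X X') (hY : IsDirectSummand R Y Y') :
    IsDirectSummand R (X × Y) (X' × Y') := by
  obtain ⟨i, p, hip⟩ := hX
  obtain ⟨j, q, hjq⟩ := hY
  exact ⟨i.prodMap j, p.prodMap q, by rw [LinearMap.prodMap_comp, hip, hjq, LinearMap.prodMap_id]⟩

theorem IsDirectSummand.piMap (hX : IsDirectSummand R X Y) (a : ℕ) :
    IsDirectSummand R (Fin a → X) (Fin a → Y) := by
  obtain ⟨i, p, hip⟩ := hX
  exact ⟨i.compLeft (Fin a), p.compLeft (Fin a),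
    LinearMap.ext fun f => funext fun j => LinearMap.congr_fun hip (f j)⟩

theorem IsDirectSummand.inAdd_of_fintype {ι : Type} [Fintype ι]
    (h : IsDirectSummand R X (ι → M)) : InAdd R M X :=
  ⟨_, h.trans (.of_equiv (LinearEquiv.funCongrLeft R M (Fintype.equivFin ι).symm))⟩

theorem InAdd.of_isDirectSummand (h : InAdd R M Y) (hX : IsDirectSummand R X Y) : InAdd R M X :=
  let ⟨n, hn⟩ := h
  ⟨n, hX.trans hn⟩

theorem InAdd.prod (hX : InAdd R M X) (hY : InAdd R M Y) : InAdd R M (X × Y) := by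
  obtain ⟨n, hn⟩ := hX
  obtain ⟨m, hm⟩ := hY
  exact ((hn.prodMap hm).trans
    (.of_equiv (LinearEquiv.sumArrowLequivProdArrow (Fin n) (Fin m) R M).symm)).inAdd_of_fintype

theorem InAdd.pi (hX : InAdd R M X) (a : ℕ) : InAdd R M (Fin a → X) := by
  obtain ⟨n, hn⟩ := hX
  exact ((hn.piMap a).trans
    (.of_equiv (LinearEquiv.curry R M (Fin a) (Fin n)).symm)).inAdd_of_fintype

theorem inAdd_of_equiv {x y : R} {a b c : ℕ}
    (e : ((Fin a → R) × (Fin b → R ⧸ Ideal.span {x}) × (Fin c → R ⧸ Ideal.span {y})) ≃ₗ[R] X)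
    (ha : 0 < a → InAdd R M R) (hb : 0 < b → InAdd R M (R ⧸ Ideal.span {x}))
    (hc : 0 < c → InAdd R M (R ⧸ Ideal.span {y})) : InAdd R M X := by
  have zero : ∀ X : Type u, [AddCommGroup X] → [Module R X] → InAdd R M (Fin 0 → X) :=
    fun X _ _ => ⟨0, 0, 0, Subsingleton.elim _ _⟩
  have key : ∀ (X : Type u) [AddCommGroup X] [Module R X] (n : ℕ), (0 < n → InAdd R M X) →
      InAdd R M (Fin n → X) := by
    intro X _ _ n hn
    rcases n with _ | n
    · exact zero X
    · exact (hn n.succ_pos).pi _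
  exact ((key _ a ha).prod ((key _ b hb).prod (key _ c hc))).of_isDirectSummand (.of_equiv e.symm)

theorem Lifts.pi {p : Y →ₗ[R] Z} (hp : Lifts M p) (a : ℕ) : Lifts M (p.compLeft (Fin a)) := by
  intro f
  choose g hg using fun j => hp (LinearMap.proj j ∘ₗ f)
  exact ⟨LinearMap.pi g, LinearMap.ext fun m => funext fun j => LinearMap.congr_fun (hg j) m⟩

end InAdd

/-! ### Global dimension of End_R(M) over a node -/

namespace IsNode

variable {R : Type u} [CommRing R] [IsLocalRing R] {x y : R} (h : IsNode R x y)

/-- The embedding `R ⧸ (y) → R` with image `(x)`. -/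
noncomputable def incl (h : IsNode R x y) : (R ⧸ Ideal.span {y}) →ₗ[R] R :=
  (Ideal.span {y}).liftQ (LinearMap.lsmul R R x) fun _ ha => h.x_mul_eq_zero_iff.mpr ha

include h

theorem incl_mk (r : R) : h.incl (Ideal.Quotient.mk _ r) = x * r := rfl

theorem incl_injective : Function.Injective h.incl := by
  rw [injective_iff_map_eq_zero]
  intro a ha
  obtain ⟨a, rfl⟩ := Ideal.Quotient.mk_surjective a
  exact Ideal.Quotient.eq_zero_iff_mem.mpr (h.x_mul_eq_zero_iff.mp ha)

theorem incl_exact : Function.Exact h.incl (Ideal.span {x}).mkQ := by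
  intro r
  rw [Submodule.mkQ_apply, Submodule.Quotient.mk_eq_zero, Ideal.mem_span_singleton]
  constructor
  · rintro ⟨s, rfl⟩
    exact ⟨Ideal.Quotient.mk _ s, rfl⟩
  · rintro ⟨s, rfl⟩
    obtain ⟨s, rfl⟩ := Ideal.Quotient.mk_surjective s
    exact ⟨s, rfl⟩

theorem one_notMem_span_pair : (1 : R) ∉ Ideal.span {x, y} := by
  rw [← h.maximalIdeal_eq, ← Ideal.ne_top_iff_one]
  exact (IsLocalRing.maximalIdeal.isMaximal R).ne_top

theorem not_exists_mul_add (a b : R) : x * a + y * b ≠ 1 := fun hab =>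
  h.one_notMem_span_pair (Ideal.mem_span_pair.mpr ⟨a, b, by rw [← hab]; ring⟩)

variable {M : Type u} [AddCommGroup M] [Module R M]

/-- Projectivity would split off Hom(M, R/y) → Hom(M, R). Applying the retraction to the projection
`e : M → R` and evaluating at `ι 1` yields an inverse of x in R/y, impossible because x and y lie in
the maximal ideal. -/
theorem not_projective_range (hR : IsDirectSummand R R M) :
    ¬ Module.Projective (Module.End R M)ᵐᵒᵖ
      (LinearMap.range (postcomp M (Ideal.span {x}).mkQ)) := by
  intro hP
  obtain ⟨ρ, hρ⟩ := exists_retraction_of_projective (postcomp_injective (M := M) h.incl_injective)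
    (postcomp_rangeRestrict_exact h.incl_injective h.incl_exact)
    (LinearMap.surjective_rangeRestrict _)
  obtain ⟨ι, e, he⟩ := hR
  let f : M →ₗ[R] R ⧸ Ideal.span {y} := (Ideal.span {y}).mkQ ∘ₗ e
  have h1 : ρ e ∘ₗ (ι ∘ₗ h.incl ∘ₗ f) = f := by
    refine Eq.trans ?_ (hρ f)
    have h2 : postcomp M h.incl f =
        MulOpposite.op ((ι ∘ₗ h.incl ∘ₗ f : M →ₗ[R] M) : Module.End R M) • e := by
      rw [op_smul_hom]
      ext m
      exact (LinearMap.congr_fun he (h.incl (f m))).symm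
    rw [h2]
    exact (map_smul ρ _ e).symm
  have h3 := LinearMap.congr_fun h1 (ι 1)
  have h4 : f (ι 1) = Ideal.Quotient.mk _ 1 := congrArg _ (LinearMap.congr_fun he 1)
  rw [LinearMap.comp_apply, LinearMap.comp_apply, LinearMap.comp_apply, h4, h.incl_mk,
    ← smul_eq_mul, map_smul, map_smul] at h3
  obtain ⟨r, hr⟩ := Ideal.Quotient.mk_surjective (ρ e (ι 1))
  rw [← hr] at h3
  have h5 : x * r - 1 ∈ Ideal.span {y} := Ideal.Quotient.eq.mp h3
  obtain ⟨s, hs⟩ := Ideal.mem_span_singleton'.mp h5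
  exact h.not_exists_mul_add r (-s) (by linear_combination -hs)

theorem not_projective_hom (hR : IsDirectSummand R R M) (hl : Lifts M (Ideal.span {x}).mkQ) :
    ¬ Module.Projective (Module.End R M)ᵐᵒᵖ (M →ₗ[R] R ⧸ Ideal.span {x}) := by
  intro hP
  have htop : LinearMap.range (postcomp M (Ideal.span {x}).mkQ) = ⊤ := LinearMap.range_eq_top.mpr hl
  refine h.not_projective_range hR ?_
  rw [htop]
  exact Module.Projective.of_equiv Submodule.topEquiv.symm

/-- Maps from the projective part lift, and a module killed by x has no nonzero map to the domain
R/y, where x ≠ 0. -/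
theorem lifts_of_equiv {F T : Type u} [AddCommGroup F] [Module R F] [AddCommGroup T] [Module R T]
    [Module.Projective R F] (hT : ∀ t : T, x • t = 0) (e : (F × T) ≃ₗ[R] M) :
    Lifts M (Ideal.span {y}).mkQ := by
  intro f
  obtain ⟨g, hg⟩ := Module.projective_lifting_property (Ideal.span {y}).mkQ
    (f ∘ₗ e.toLinearMap ∘ₗ LinearMap.inl R F T) (Ideal.span {y}).mkQ_surjective
  refine ⟨g ∘ₗ LinearMap.fst R F T ∘ₗ e.symm.toLinearMap, LinearMap.ext fun m => ?_⟩
  obtain ⟨⟨u, t⟩, rfl⟩ := e.surjective m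
  have h0 : f (e (0, t)) = 0 := by
    obtain ⟨r, hr⟩ := Ideal.Quotient.mk_surjective (f (e (0, t)))
    have h1 : x • f (e (0, t)) = 0 := by
      rw [← map_smul, ← map_smul, Prod.smul_mk, hT, smul_zero]
      exact (congrArg f e.map_zero).trans f.map_zero
    rw [← hr] at h1 ⊢
    exact Ideal.Quotient.eq_zero_iff_mem.mpr (h.mem_of_x_mul_mem
      (Ideal.Quotient.eq_zero_iff_mem.mp h1))
  have h2 : ((u, t) : F × T) = (u, 0) + (0, t) := by simp
  have h3 := LinearMap.congr_fun hg u
  simp only [LinearMap.comp_apply, LinearEquiv.coe_coe, LinearEquiv.symm_apply_apply,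
    LinearMap.fst_apply] at h3 ⊢
  rw [h2, map_add, map_add, h0, add_zero]
  exact h3

theorem two_le_globalDimEnd (hR : IsDirectSummand R R M)
    (hx : IsDirectSummand R (R ⧸ Ideal.span {x}) M) :
    ((2 : ℕ) : WithBot ℕ∞) ≤ globalDimEnd R M :=
  le_globalDim_of_not_hasProjectiveDimensionLT
    (X := _ ⧸ LinearMap.range (postcomp M (Ideal.span {x}).mkQ)) 2 fun hc =>
    h.not_projective_range hR (hasProjectiveDimensionLT_one_iff.mp
      ((hasProjectiveDimensionLT_quotient_iff hx.inAdd _ 0).mp hc))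

theorem three_le_globalDimEnd (hR : IsDirectSummand R R M)
    (hx : IsDirectSummand R (R ⧸ Ideal.span {x}) M) (hl : Lifts M (Ideal.span {y}).mkQ) :
    ((3 : ℕ) : WithBot ℕ∞) ≤ globalDimEnd R M :=
  le_globalDim_of_not_hasProjectiveDimensionLT
    (X := _ ⧸ LinearMap.range (postcomp M (Ideal.span {x}).mkQ)) 3 fun hc =>
    h.symm.not_projective_hom hR hl (hasProjectiveDimensionLT_one_iff.mp
      ((hasProjectiveDimensionLT_range_iff h.incl_injective h.incl_exact hR.inAdd 0).mp
        ((hasProjectiveDimensionLT_quotient_iff hx.inAdd _ 1).mp hc)))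

/-- The syzygy of Hom(M, R/x) is Hom(M, R/y) and conversely, so the resolution is periodic and never
reaches a projective. -/
theorem not_hasProjectiveDimensionLT_hom (hR : IsDirectSummand R R M)
    (hx : Lifts M (Ideal.span {x}).mkQ) (hy : Lifts M (Ideal.span {y}).mkQ) (n : ℕ) :
    ¬ HasProjectiveDimensionLT
      (ModuleCat.of (Module.End R M)ᵐᵒᵖ (M →ₗ[R] R ⧸ Ideal.span {x})) (n + 1) := by
  induction n generalizing x y with
  | zero => exact fun hc => h.not_projective_hom hR hx (hasProjectiveDimensionLT_one_iff.mp hc)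
  | succ n ih =>
    exact fun hc => ih h.symm hy hx
      ((hasProjectiveDimensionLT_hom_iff h.incl_injective h.incl_exact hx hR.inAdd n).mp hc)

theorem not_globalDimEnd_le (hR : IsDirectSummand R R M) (hx : Lifts M (Ideal.span {x}).mkQ)
    (hy : Lifts M (Ideal.span {y}).mkQ) (n : ℕ) : ¬ globalDimEnd R M ≤ n := fun hc =>
  h.not_hasProjectiveDimensionLT_hom hR hx hy n (hasProjectiveDimensionLT_of_globalDim_le hc)

variable [Module.Finite R M]

theorem inAdd_of_smul_eq_zero (hM : IsSMulRegular M (x + y)) (hx : ∀ m : M, x • m = 0) :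
    InAdd R (R ⧸ Ideal.span {x}) M := by
  obtain ⟨a, b, c, ⟨e⟩⟩ := h.exists_equiv hM
  have hx' : ∀ t, x • t = (0 : (Fin a → R) × (Fin b → R ⧸ Ideal.span {x}) ×
      (Fin c → R ⧸ Ideal.span {y})) := fun t => e.injective (by rw [map_smul, hx, map_zero])
  refine inAdd_of_equiv e (fun ha => ?_) (fun _ => inAdd_self) fun hc => ?_
  · have h1 := congrFun (congrArg Prod.fst (hx' (fun _ => 1, 0, 0))) ⟨0, ha⟩
    simp only [Prod.smul_fst, Pi.smul_apply, smul_eq_mul, mul_one, Prod.fst_zero,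
      Pi.zero_apply] at h1
    exact (h.x_notMem (h1 ▸ Ideal.zero_mem _)).elim
  · have h1 := congrFun (congrArg (fun t => t.2.2) (hx' (0, 0, fun _ => Ideal.Quotient.mk _ 1)))
      ⟨0, hc⟩
    have h2 : x * 1 ∈ Ideal.span {y} := Ideal.Quotient.eq_zero_iff_mem.mp h1
    rw [mul_one] at h2
    exact (h.x_notMem h2).elim

/-- All indecomposable MCM modules lie in add M, hence so does every ker G. -/
theorem globalDimEnd_eq_two (hM : IsSMulRegular M (x + y)) (hR : IsDirectSummand R R M)
    (hx : IsDirectSummand R (R ⧸ Ideal.span {x}) M)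
    (hy : IsDirectSummand R (R ⧸ Ideal.span {y}) M) :
    globalDimEnd R M = ((2 : ℕ) : WithBot ℕ∞) := by
  have := h.noetherian
  refine le_antisymm (globalDimEnd_le_of_ker 0 fun m G => ?_) (h.two_le_globalDimEnd hR hx)
  have hreg : IsSMulRegular (LinearMap.ker G) (x + y) :=
    (IsSMulRegular.pi fun _ => hM).submodule _ _
  obtain ⟨a, b, c, ⟨e⟩⟩ := h.exists_equiv (M := LinearMap.ker G) hreg
  exact hasProjectiveDimensionLT_one_iff.mpr (inAdd_of_equiv e (fun _ => hR.inAdd)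
    (fun _ => hx.inAdd) (fun _ => hy.inAdd)).projective_hom

theorem globalDimEnd_eq_three (hM : IsSMulRegular M (x + y)) (hR : IsDirectSummand R R M)
    (hx : IsDirectSummand R (R ⧸ Ideal.span {x}) M) (hl : Lifts M (Ideal.span {y}).mkQ) :
    globalDimEnd R M = ((3 : ℕ) : WithBot ℕ∞) := by
  have := h.noetherian
  refine le_antisymm (globalDimEnd_le_of_ker 1 fun m G => ?_) (h.three_le_globalDimEnd hR hx hl)
  have hreg : IsSMulRegular (LinearMap.ker G) (x + y) :=
    (IsSMulRegular.pi fun _ => hM).submodule _ _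
  obtain ⟨a, b, c, ⟨e⟩⟩ := h.exists_equiv (M := LinearMap.ker G) hreg
  -- Only the summands R/y of ker G may fall outside add M; they are covered by copies of R. The
  -- kernel of `p` is (y)^c, which is killed by `x` and thus lies in add R/x.
  let p : ((Fin a → R) × (Fin b → R ⧸ Ideal.span {x}) × (Fin c → R)) →ₗ[R] LinearMap.ker G :=
    e.toLinearMap ∘ₗ LinearMap.prodMap LinearMap.id
      (LinearMap.prodMap LinearMap.id ((Ideal.span {y}).mkQ.compLeft (Fin c)))
  have hp : Lifts M p := by
    intro f
    let f' := e.symm.toLinearMap ∘ₗ f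
    obtain ⟨g, hg⟩ := hl.pi c (LinearMap.snd R _ _ ∘ₗ LinearMap.snd R _ _ ∘ₗ f')
    refine ⟨(LinearMap.fst R _ _ ∘ₗ f').prod ((LinearMap.fst R _ _ ∘ₗ LinearMap.snd R _ _ ∘ₗ
      f').prod g), LinearMap.ext fun m => ?_⟩
    rw [← e.apply_symm_apply (f m)]
    exact congrArg e (Prod.ext rfl (Prod.ext rfl (LinearMap.congr_fun hg m)))
  have hY : InAdd R M ((Fin a → R) × (Fin b → R ⧸ Ideal.span {x}) × (Fin c → R)) :=
    (hR.inAdd.pi a).prod ((hx.inAdd.pi b).prod (hR.inAdd.pi c))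
  refine (hasProjectiveDimensionLT_hom_iff (LinearMap.ker p).injective_subtype
    (exact_subtype_ker p) hp hY 0).mpr (hasProjectiveDimensionLT_one_iff.mpr
    (InAdd.projective_hom ?_))
  have hker : ∀ t : LinearMap.ker p, x • t = 0 := by
    rintro ⟨⟨r, s, u⟩, ht⟩
    have ht' := e.injective ((LinearMap.mem_ker.mp ht).trans e.map_zero.symm)
    have h1 : r = 0 := congrArg Prod.fst ht'
    have h2 : s = 0 := congrArg (fun t => t.2.1) ht'
    have h3 : ∀ j, x * u j = 0 := fun j => h.x_mul_eq_zero_iff.mpr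
      (Ideal.Quotient.eq_zero_iff_mem.mp (congrFun (congrArg (fun t => t.2.2) ht') j))
    refine Subtype.ext (Prod.ext ?_ (Prod.ext ?_ (funext h3)))
    · exact (congrArg (x • ·) h1).trans (smul_zero _)
    · exact (congrArg (x • ·) h2).trans (smul_zero _)
  have hreg' : IsSMulRegular (LinearMap.ker p) (x + y) := by
    refine (isSMulRegular_prod (IsSMulRegular.pi fun _ => ?_) (isSMulRegular_prod
      (IsSMulRegular.pi fun _ => ?_) (IsSMulRegular.pi fun _ => ?_))).submodule _ _
    exacts [h.isSMulRegular_self, h.isSMulRegular_quotient, h.isSMulRegular_self]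
  obtain ⟨n, hn⟩ := h.inAdd_of_smul_eq_zero (M := LinearMap.ker p) hreg' hker
  exact (hx.inAdd.pi n).of_isDirectSummand hn

/-- If `M` is the sum of a part killed by `x` and a part killed by `y`, then the images of maps
`M ^ n → M` are direct summands of `M ^ n`. -/
theorem exists_section_range (hM : IsSMulRegular M (x + y))
    (hs : ∀ m : M, ∃ u v : M, m = u + v ∧ x • u = 0 ∧ y • v = 0) {n : ℕ}
    (G : (Fin n → M) →ₗ[R] M) :
    ∃ σ : LinearMap.range G →ₗ[R] (Fin n → M), ∀ l, G (σ l) = l := by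
  have := h.noetherian
  have hreg : IsSMulRegular (LinearMap.range G) (x + y) := hM.submodule _ _
  obtain ⟨a, b, c, ⟨e⟩⟩ := h.exists_equiv hreg
  have hs' : ∀ l : LinearMap.range G, ∃ u v : Fin n → M, G u + G v = l ∧
      (∀ j, x • u j = 0) ∧ ∀ j, y • v j = 0 := by
    rintro ⟨_, w, rfl⟩
    choose u v huv hu hv using fun j => hs (w j)
    exact ⟨u, v, by rw [← map_add]; exact congrArg G (funext fun j => (huv j).symm), hu, hv⟩
  have hx : ∀ l : LinearMap.range G, x • l = 0 → ∃ u : Fin n → M, G u = l ∧ x • u = 0 := by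
    intro l hl
    obtain ⟨u, v, huv, hu, hv⟩ := hs' l
    have hu' : x • u = 0 := funext hu
    have hv' : y • v = 0 := funext hv
    refine ⟨u, ?_, hu'⟩
    -- `G v` is killed by y because `v` is, and by x because both `l` and `G u` are.
    have hGv : G v = 0 := by
      refine eq_zero_of_smul hM ?_ (by rw [← map_smul, hv', map_zero])
      have := congrArg (Subtype.val) hl
      rw [Submodule.coe_smul, ← huv, smul_add, ← map_smul, hu', map_zero, zero_add] at this
      exact this
    rw [← huv, hGv, add_zero]
  have hy : ∀ l : LinearMap.range G, y • l = 0 → ∃ v : Fin n → M, G v = l ∧ y • v = 0 := by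
    intro l hl
    obtain ⟨u, v, huv, hu, hv⟩ := hs' l
    have hu' : x • u = 0 := funext hu
    have hv' : y • v = 0 := funext hv
    refine ⟨v, ?_, hv'⟩
    have hGu : G u = 0 := by
      refine eq_zero_of_smul hM (by rw [← map_smul, hu', map_zero]) ?_
      have := congrArg (Subtype.val) hl
      rw [Submodule.coe_smul, ← huv, smul_add, ← map_smul _ y v, hv', map_zero, add_zero] at this
      exact this
    rw [← huv, hGu, zero_add]
  -- A free coordinate would write 1 = r + s with xr = 0 and ys = 0, putting 1 in (x, y).
  have ha : IsEmpty (Fin a) := by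
    refine ⟨fun i => ?_⟩
    obtain ⟨u, v, huv, hu, hv⟩ := hs' (e (fun _ => 1, 0, 0))
    let pr : LinearMap.range G →ₗ[R] R :=
      LinearMap.proj i ∘ₗ LinearMap.fst R _ _ ∘ₗ e.symm.toLinearMap
    let Gu : LinearMap.range G := ⟨G u, u, rfl⟩
    let Gv : LinearMap.range G := ⟨G v, v, rfl⟩
    have h1 : pr Gu + pr Gv = 1 := by
      rw [← map_add, show Gu + Gv = e (fun _ => 1, 0, 0) from Subtype.ext huv]
      simp [pr]
    have h2 : x * pr Gu = 0 := by
      rw [← smul_eq_mul, ← map_smul,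
        show x • Gu = 0 from Subtype.ext ((map_smul G x u).symm.trans
          ((congrArg G (funext hu)).trans (map_zero G))), map_zero]
    have h3 : y * pr Gv = 0 := by
      rw [← smul_eq_mul, ← map_smul,
        show y • Gv = 0 from Subtype.ext ((map_smul G y v).symm.trans
          ((congrArg G (funext hv)).trans (map_zero G))), map_zero]
    obtain ⟨r, hr⟩ := Ideal.mem_span_singleton'.mp (h.x_mul_eq_zero_iff.mp h2)
    obtain ⟨s, hs⟩ := Ideal.mem_span_singleton'.mp (h.symm.x_mul_eq_zero_iff.mp h3)
    exact h.not_exists_mul_add s r (by linear_combination hr + hs + h1)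
  choose u hu hu' using fun i => hx (e (0, fun j => Ideal.Quotient.mk _ ((Pi.single i 1 : Fin b → R) j), 0)) (by
    rw [← map_smul]
    refine (congrArg e (Prod.ext (smul_zero _) (Prod.ext (funext fun j => ?_) (smul_zero _)))).trans
      e.map_zero
    exact Ideal.Quotient.eq_zero_iff_mem.mpr
      (Ideal.mul_mem_right _ _ (Ideal.mem_span_singleton_self x)))
  choose v hv hv' using fun i => hy (e (0, 0, fun j => Ideal.Quotient.mk _ ((Pi.single i 1 : Fin c → R) j))) (by
    rw [← map_smul]
    refine (congrArg e (Prod.ext (smul_zero _) (Prod.ext (smul_zero _) (funext fun j => ?_)))).trans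
      e.map_zero
    exact Ideal.Quotient.eq_zero_iff_mem.mpr
      (Ideal.mul_mem_right _ _ (Ideal.mem_span_singleton_self y)))
  -- The section sends branch generators to preimages killed by the same element, so it is well
  -- defined on R/x and R/y.
  let τ := (0 : (Fin a → R) →ₗ[R] (Fin n → M)).coprod ((quotHom x u hu').coprod (quotHom y v hv'))
  refine ⟨τ ∘ₗ e.symm.toLinearMap, fun l => ?_⟩
  obtain ⟨⟨r, s, t⟩, rfl⟩ := e.surjective l
  obtain ⟨s, rfl⟩ := exists_eq_mk s
  obtain ⟨t, rfl⟩ := exists_eq_mk t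
  have h1 : (r, (fun i => Ideal.Quotient.mk _ (s i)), fun i => Ideal.Quotient.mk _ (t i)) =
      (∑ i, s i • ((0, fun j => Ideal.Quotient.mk _ ((Pi.single i 1 : Fin b → R) j), 0) :
        (Fin a → R) × (Fin b → R ⧸ Ideal.span {x}) × (Fin c → R ⧸ Ideal.span {y}))) +
      ∑ i, t i • ((0, 0, fun j => Ideal.Quotient.mk _ ((Pi.single i 1 : Fin c → R) j)) :
        (Fin a → R) × (Fin b → R ⧸ Ideal.span {x}) × (Fin c → R ⧸ Ideal.span {y})) := by
    refine Prod.ext (Subsingleton.elim _ _) (Prod.ext (funext fun j => ?_) (funext fun j => ?_))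
    · simp [Prod.snd_sum, Prod.fst_sum, Pi.single_apply, Algebra.smul_def]
    · simp [Prod.snd_sum, Finset.sum_apply, Pi.single_apply, Algebra.smul_def]
  have h2 : (τ (r, (fun i => Ideal.Quotient.mk _ (s i)), fun i => Ideal.Quotient.mk _ (t i))) =
      ∑ i, s i • u i + ∑ i, t i • v i := by
    simp only [τ, LinearMap.coprod_apply, quotHom_mk, LinearMap.zero_apply, zero_add]
  rw [LinearMap.comp_apply, LinearEquiv.coe_coe, e.symm_apply_apply, h2, h1]
  simp only [map_add, map_sum, map_smul, hu, hv, Submodule.coe_add, Submodule.coe_sum,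
    Submodule.coe_smul]

theorem globalDimEnd_eq_one [Nontrivial M] (hM : IsSMulRegular M (x + y))
    (hs : ∀ m : M, ∃ u v : M, m = u + v ∧ x • u = 0 ∧ y • v = 0) :
    globalDimEnd R M = ((1 : ℕ) : WithBot ℕ∞) :=
  have := h.noetherian
  le_antisymm (globalDimEnd_le_one fun _ G => h.exists_section_range hM hs G)
    (one_le_globalDimEnd h.add_mem hM)

end IsNode

/-! ### Additivity of Ext¹ and indecomposable modules -/

section Ext

variable {R : Type u} [CommRing R] {X Y Z : Type u} [AddCommGroup X] [Module R X]
  [AddCommGroup Y] [Module R Y] [AddCommGroup Z] [Module R Z]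

open Abelian

theorem ExtOneVanishes.of_left (h : ExtOneVanishes R X Y) (hZ : IsDirectSummand R Z X) :
    ExtOneVanishes R Z Y := by
  obtain ⟨i, p, hip⟩ := hZ
  refine subsingleton_of_forall_eq 0 fun e => ?_
  have h1 : ModuleCat.ofHom i ≫ ModuleCat.ofHom p = 𝟙 _ := by
    rw [← ModuleCat.ofHom_comp, hip]; rfl
  rw [← Ext.mk₀_id_comp e, ← h1, ← Ext.mk₀_comp_mk₀_assoc,
    h.elim ((Ext.mk₀ (ModuleCat.ofHom p)).comp e (zero_add 1)) 0, Ext.comp_zero]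

theorem ExtOneVanishes.of_right (h : ExtOneVanishes R X Y) (hZ : IsDirectSummand R Z Y) :
    ExtOneVanishes R X Z := by
  obtain ⟨i, p, hip⟩ := hZ
  refine subsingleton_of_forall_eq 0 fun e => ?_
  have h1 : ModuleCat.ofHom i ≫ ModuleCat.ofHom p = 𝟙 _ := by
    rw [← ModuleCat.ofHom_comp, hip]; rfl
  rw [← Ext.comp_mk₀_id e, ← h1, ← Ext.mk₀_comp_mk₀,
    ← Ext.comp_assoc_of_third_deg_zero,
    h.elim (e.comp (Ext.mk₀ (ModuleCat.ofHom i)) (add_zero 1)) 0, Ext.zero_comp]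

theorem ExtOneVanishes.prod_left (hX : ExtOneVanishes R X Z) (hY : ExtOneVanishes R Y Z) :
    ExtOneVanishes R (X × Y) Z := by
  refine subsingleton_of_forall_eq 0 fun e => ?_
  have h1 : 𝟙 (ModuleCat.of R (X × Y)) =
      ModuleCat.ofHom (LinearMap.fst R X Y) ≫ ModuleCat.ofHom (LinearMap.inl R X Y) +
      ModuleCat.ofHom (LinearMap.snd R X Y) ≫ ModuleCat.ofHom (LinearMap.inr R X Y) := by
    ext m <;> simp
  rw [← Ext.mk₀_id_comp e, h1, Ext.mk₀_add, Ext.add_comp, ← Ext.mk₀_comp_mk₀_assoc,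
    ← Ext.mk₀_comp_mk₀_assoc,
    hX.elim ((Ext.mk₀ (ModuleCat.ofHom (LinearMap.inl R X Y))).comp e (zero_add 1)) 0,
    hY.elim ((Ext.mk₀ (ModuleCat.ofHom (LinearMap.inr R X Y))).comp e (zero_add 1)) 0,
    Ext.comp_zero, Ext.comp_zero, add_zero]

theorem ExtOneVanishes.prod_right (hX : ExtOneVanishes R Z X) (hY : ExtOneVanishes R Z Y) :
    ExtOneVanishes R Z (X × Y) := by
  refine subsingleton_of_forall_eq 0 fun e => ?_
  have h1 : 𝟙 (ModuleCat.of R (X × Y)) =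
      ModuleCat.ofHom (LinearMap.fst R X Y) ≫ ModuleCat.ofHom (LinearMap.inl R X Y) +
      ModuleCat.ofHom (LinearMap.snd R X Y) ≫ ModuleCat.ofHom (LinearMap.inr R X Y) := by
    ext m <;> simp
  rw [← Ext.comp_mk₀_id e, h1, Ext.mk₀_add, Ext.comp_add, ← Ext.mk₀_comp_mk₀,
    ← Ext.mk₀_comp_mk₀, ← Ext.comp_assoc_of_third_deg_zero, ← Ext.comp_assoc_of_third_deg_zero,
    hX.elim (e.comp (Ext.mk₀ (ModuleCat.ofHom (LinearMap.fst R X Y))) (add_zero 1)) 0,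
    hY.elim (e.comp (Ext.mk₀ (ModuleCat.ofHom (LinearMap.snd R X Y))) (add_zero 1)) 0,
    Ext.zero_comp, Ext.zero_comp, add_zero]

theorem extOneVanishes_of_projective [Module.Projective R X] : ExtOneVanishes R X Y :=
  have : Projective (ModuleCat.of R X) := (IsProjective.iff_projective X).mp inferInstance
  subsingleton_of_forall_eq 0 fun e => Ext.eq_zero_of_projective e

theorem pi_succ_equiv (R X : Type u) [CommRing R] [AddCommGroup X] [Module R X] (n : ℕ) :
    Nonempty ((Fin (n + 1) → X) ≃ₗ[R] X × (Fin n → X)) :=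
  ⟨(Fin.consLinearEquiv R fun _ => X).symm⟩

theorem ExtOneVanishes.pi_left (h : ExtOneVanishes R X Y) (n : ℕ) :
    ExtOneVanishes R (Fin n → X) Y := by
  induction n with
  | zero => exact extOneVanishes_of_projective
  | succ n ih =>
    obtain ⟨e⟩ := pi_succ_equiv R X n
    exact (h.prod_left ih).of_left (.of_equiv e)

theorem ExtOneVanishes.pi_right (h : ExtOneVanishes R X Y) (n : ℕ) :
    ExtOneVanishes R X (Fin n → Y) := by
  induction n with
  | zero => exact h.of_right ⟨0, 0, Subsingleton.elim _ _⟩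
  | succ n ih =>
    obtain ⟨e⟩ := pi_succ_equiv R Y n
    exact (h.prod_right ih).of_right (.of_equiv e)

/-- The complement of a nonzero summand of `X` must vanish, so `X` is isomorphic to `Z`. -/
theorem IsIndecomposable.isDirectSummand (hX : IsIndecomposable R X) [Nontrivial Z]
    (h : IsDirectSummand R Z X) : IsDirectSummand R X Z := by
  obtain ⟨i, p, hip⟩ := h
  have hip' : ∀ z, p (i z) = z := LinearMap.congr_fun hip
  have hc : IsCompl (LinearMap.range i) (LinearMap.ker p) := by
    constructor
    · rw [Submodule.disjoint_def]
      rintro _ ⟨z, rfl⟩ hz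
      rw [LinearMap.mem_ker, hip'] at hz
      rw [hz, map_zero]
    · rw [codisjoint_iff_le_sup]
      intro m _
      rw [← add_sub_cancel (i (p m)) m]
      exact Submodule.add_mem_sup ⟨p m, rfl⟩ (by rw [LinearMap.mem_ker, map_sub, hip', sub_self])
  rcases hX.eq_bot_or_eq_bot _ _ hc with h0 | h0
  · obtain ⟨z, hz⟩ := exists_ne (0 : Z)
    rw [LinearMap.range_eq_bot] at h0
    exact (hz (by rw [← hip' z, h0, LinearMap.zero_apply, map_zero])).elim
  · exact ⟨p, i, LinearMap.ext fun m => LinearMap.ker_eq_bot.mp h0 (hip' (p m))⟩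

end Ext

theorem smul_quotient_eq_zero {R : Type u} [CommRing R] {x : R} 
    (q : R ⧸ Ideal.span {x}) : x • q = 0 := by
  obtain ⟨q, rfl⟩ := Ideal.Quotient.mk_surjective q
  exact Ideal.Quotient.eq_zero_iff_mem.mpr
    (Ideal.mul_mem_right _ _ (Ideal.mem_span_singleton_self x))

/-! ### Cluster tilting, the representation generator and the spectrum -/

namespace IsNode

section

variable {R : Type u} [CommRing R] {x y : R} {M : Type u} [AddCommGroup M] [Module R M]
  {a b c : ℕ} (e : ((Fin a → R) × (Fin b → R ⧸ Ideal.span {x}) ×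
    (Fin c → R ⧸ Ideal.span {y})) ≃ₗ[R] M)
include e

theorem isDirectSummand_self (ha : 0 < a) : IsDirectSummand R R M :=
  (((IsDirectSummand.pi R R ⟨0, ha⟩).trans (.fst R _ _)).trans (.of_equiv e))

theorem isDirectSummand_quotient_x (hb : 0 < b) : IsDirectSummand R (R ⧸ Ideal.span {x}) M :=
  ((((IsDirectSummand.pi R _ ⟨0, hb⟩).trans (.fst R _ _)).trans (.snd R _ _)).trans (.of_equiv e))

theorem isDirectSummand_quotient_y (hc : 0 < c) : IsDirectSummand R (R ⧸ Ideal.span {y}) M :=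
  ((((IsDirectSummand.pi R _ ⟨0, hc⟩).trans (.snd R _ _)).trans (.snd R _ _)).trans (.of_equiv e))

end

variable {R : Type u} [CommRing R] [IsLocalRing R] {x y : R} (h : IsNode R x y)
include h

/-- In 0 → R/y → R → R/x → 0, a map R/y → W is an element of W killed by y, and it extends along
multiplication by x exactly when that element is divisible by x. -/
theorem extOneVanishes_quotient_iff (W : Type u) [AddCommGroup W] [Module R W] :
    ExtOneVanishes R (R ⧸ Ideal.span {x}) W ↔ ∀ w : W, y • w = 0 → ∃ w', x • w' = w := by
  rw [ExtOneVanishes, ext_one_subsingleton_iff h.incl_injective h.incl_exact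
    (Ideal.span {x}).mkQ_surjective]
  constructor
  · intro hl w hw
    obtain ⟨ψ, hψ⟩ := hl ((Ideal.span {y}).liftQ (LinearMap.toSpanSingleton R W w)
      (by rw [Ideal.span, Submodule.span_le]; simpa using hw))
    refine ⟨ψ 1, ?_⟩
    have h1 := LinearMap.congr_fun hψ (Ideal.Quotient.mk _ 1)
    rw [LinearMap.comp_apply, h.incl_mk, ← smul_eq_mul, map_smul] at h1
    exact h1.trans (one_smul R w)
  · intro hl φ
    obtain ⟨w, hw⟩ := hl (φ (Ideal.Quotient.mk _ 1)) (by
      rw [← map_smul]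
      refine (congrArg φ ?_).trans φ.map_zero
      exact Ideal.Quotient.eq_zero_iff_mem.mpr
        (Ideal.mul_mem_right _ _ (Ideal.mem_span_singleton_self y)))
    refine ⟨LinearMap.toSpanSingleton R W w, LinearMap.ext fun r => ?_⟩
    obtain ⟨r, rfl⟩ := Ideal.Quotient.mk_surjective r
    have h2 : Ideal.Quotient.mk (Ideal.span {y}) r = r • Ideal.Quotient.mk (Ideal.span {y}) 1 := by
      rw [← mul_one r, map_mul, mul_one]; rfl
    rw [LinearMap.comp_apply, h.incl_mk, h2, map_smul, ← hw, LinearMap.toSpanSingleton_apply,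
      mul_comm, mul_smul]

theorem not_extOneVanishes : ¬ ExtOneVanishes R (R ⧸ Ideal.span {x}) (R ⧸ Ideal.span {y}) := by
  rw [h.extOneVanishes_quotient_iff]
  intro hl
  obtain ⟨w, hw⟩ := hl (Ideal.Quotient.mk _ 1) (Ideal.Quotient.eq_zero_iff_mem.mpr
    (Ideal.mul_mem_right _ _ (Ideal.mem_span_singleton_self y)))
  obtain ⟨w, rfl⟩ := Ideal.Quotient.mk_surjective w
  have h5 : x * w - 1 ∈ Ideal.span {y} := Ideal.Quotient.eq.mp hw
  obtain ⟨s, hs⟩ := Ideal.mem_span_singleton'.mp h5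
  exact h.not_exists_mul_add w (-s) (by linear_combination -hs)

theorem isSMulRegular_self_prod : IsSMulRegular (R × R ⧸ Ideal.span {x}) (x + y) :=
  isSMulRegular_prod h.isSMulRegular_self h.isSMulRegular_quotient

theorem extOneVanishes_self_prod :
    ExtOneVanishes R (R × R ⧸ Ideal.span {x}) (R × R ⧸ Ideal.span {x}) := by
  refine extOneVanishes_of_projective.prod_left (.prod_right ?_ ?_)
  · rw [h.extOneVanishes_quotient_iff]
    intro w hw
    obtain ⟨s, rfl⟩ := Ideal.mem_span_singleton'.mp (h.symm.x_mul_eq_zero_iff.mp hw)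
    exact ⟨s, mul_comm _ _⟩
  · rw [h.extOneVanishes_quotient_iff]
    intro w hw
    obtain ⟨w, rfl⟩ := Ideal.Quotient.mk_surjective w
    exact ⟨0, (smul_zero _).trans (Ideal.Quotient.eq_zero_iff_mem.mpr
      (h.symm.mem_of_x_mul_mem (Ideal.Quotient.eq_zero_iff_mem.mp hw))).symm⟩

theorem isMCM_of_inAdd {M X : Type u} [AddCommGroup M] [Module R M] [AddCommGroup X] [Module R X]
    (hM : IsMCM R M) (hX : InAdd R M X) : IsMCM R X := by
  obtain ⟨n, hn⟩ := hX
  obtain ⟨hfin, hreg⟩ := h.isMCM_iff.mp hM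
  exact h.isMCM_iff.mpr ⟨hn.finite, hn.isSMulRegular (IsSMulRegular.pi fun _ => hreg)⟩

theorem isClusterTilting : IsClusterTilting R (R × R ⧸ Ideal.span {x}) := by
  have hM : IsMCM R (R × R ⧸ Ideal.span {x}) :=
    h.isMCM_iff.mpr ⟨inferInstance, h.isSMulRegular_self_prod⟩
  have hR : IsDirectSummand R R (R × R ⧸ Ideal.span {x}) := .fst R _ _
  have hx : IsDirectSummand R (R ⧸ Ideal.span {x}) (R × R ⧸ Ideal.span {x}) := .snd R _ _
  -- R/y is the only indecomposable missing from add M, and it has nonzero Ext¹ with R/x on either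
  -- side; so both Ext conditions just exclude it as a summand.
  have key : ∀ (X : Type u) [AddCommGroup X] [Module R X], IsMCM R X →
      ¬ IsDirectSummand R (R ⧸ Ideal.span {y}) X → InAdd R (R × R ⧸ Ideal.span {x}) X := by
    intro X _ _ hX hy
    obtain ⟨hfin, hreg⟩ := h.isMCM_iff.mp hX
    obtain ⟨a, b, c, ⟨e⟩⟩ := h.exists_equiv hreg
    exact inAdd_of_equiv e (fun _ => hR.inAdd) (fun _ => hx.inAdd)
      fun hc => (hy (isDirectSummand_quotient_y e hc)).elim
  refine ⟨hM, fun X _ _ => ⟨fun hX => ⟨h.isMCM_of_inAdd hM hX, ?_⟩, fun hX => key X hX.1 ?_⟩,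
    fun X _ _ => ⟨fun hX => ⟨h.isMCM_of_inAdd hM hX, ?_⟩, fun hX => key X hX.1 ?_⟩⟩
  · obtain ⟨n, hn⟩ := hX
    exact (h.extOneVanishes_self_prod.pi_left n).of_left hn
  · exact fun hy => h.symm.not_extOneVanishes ((hX.2.of_left hy).of_right hx)
  · obtain ⟨n, hn⟩ := hX
    exact (h.extOneVanishes_self_prod.pi_right n).of_right hn
  · exact fun hy => h.not_extOneVanishes ((hX.2.of_left hx).of_right hy)

theorem isSMulRegular_prod_prod :
    IsSMulRegular (R × (R ⧸ Ideal.span {x}) × (R ⧸ Ideal.span {y})) (x + y) :=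
  isSMulRegular_prod h.isSMulRegular_self
    (isSMulRegular_prod h.isSMulRegular_quotient h.isSMulRegular_quotient')

theorem isRepresentationGenerator :
    IsRepresentationGenerator R (R × (R ⧸ Ideal.span {x}) × (R ⧸ Ideal.span {y})) := by
  have := h.nontrivial_quotient
  have := h.symm.nontrivial_quotient
  refine ⟨h.isMCM_iff.mpr ⟨inferInstance, h.isSMulRegular_prod_prod⟩, fun X _ _ hX hi => ?_⟩
  obtain ⟨hfin, hreg⟩ := h.isMCM_iff.mp hX
  obtain ⟨a, b, c, ⟨e⟩⟩ := h.exists_equiv hreg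
  rcases Nat.eq_zero_or_pos a with rfl | ha
  · rcases Nat.eq_zero_or_pos b with rfl | hb
    · rcases Nat.eq_zero_or_pos c with rfl | hc
      · have := hi.nontrivial
        exact (not_subsingleton X e.symm.toEquiv.subsingleton).elim
      · exact (hi.isDirectSummand (isDirectSummand_quotient_y e hc)).trans
          ((IsDirectSummand.snd R _ _).trans (.snd R _ _))
    · exact (hi.isDirectSummand (isDirectSummand_quotient_x e hb)).trans
        ((IsDirectSummand.fst R _ _).trans (.snd R _ _))
  · exact (hi.isDirectSummand (isDirectSummand_self e ha)).trans (.fst R _ _)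

theorem globalDimEnd_prod_prod :
    globalDimEnd R (R × (R ⧸ Ideal.span {x}) × (R ⧸ Ideal.span {y})) = ((2 : ℕ) : WithBot ℕ∞) :=
  h.globalDimEnd_eq_two h.isSMulRegular_prod_prod (.fst R _ _)
    ((IsDirectSummand.fst R _ _).trans (.snd R _ _))
    ((IsDirectSummand.snd R _ _).trans (.snd R _ _))

theorem globalDimEnd_self_prod :
    globalDimEnd R (R × R ⧸ Ideal.span {x}) = ((3 : ℕ) : WithBot ℕ∞) :=
  h.globalDimEnd_eq_three h.isSMulRegular_self_prod (.fst R _ _) (.snd R _ _)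
    (h.lifts_of_equiv smul_quotient_eq_zero (.refl R _))

theorem globalDimEnd_eq_one_of_equiv {M P Q : Type u} [AddCommGroup M] [Module R M]
    [AddCommGroup P] [Module R P] [AddCommGroup Q] [Module R Q] [Module.Finite R M] [Nontrivial M]
    (hM : IsSMulRegular M (x + y)) (e : M ≃ₗ[R] P × Q) (hP : ∀ p : P, x • p = 0)
    (hQ : ∀ q : Q, y • q = 0) : globalDimEnd R M = ((1 : ℕ) : WithBot ℕ∞) := by
  refine h.globalDimEnd_eq_one hM fun m => ⟨e.symm ((e m).1, 0), e.symm (0, (e m).2), ?_, ?_, ?_⟩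
  · rw [← map_add, Prod.mk_add_mk, add_zero, zero_add]
    exact (e.symm_apply_apply m).symm
  · rw [← map_smul, Prod.smul_mk, hP, smul_zero]
    exact e.symm.map_zero
  · rw [← map_smul, Prod.smul_mk, hQ, smul_zero]
    exact e.symm.map_zero

/-- The value depends only on which of the exponents a, b, c vanish; the free case b = c = 0 is
excluded by finiteness. -/
theorem globalDimEnd_of_nontrivial {M : Type u} [AddCommGroup M] [Module R M] [Module.Finite R M]
    [Nontrivial M] (hM : IsSMulRegular M (x + y)) {n : ℕ}
    (hn : globalDimEnd R M = (n : WithBot ℕ∞)) : n = 1 ∨ n = 2 ∨ n = 3 := by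
  have cast : ∀ {m : ℕ}, globalDimEnd R M = (m : WithBot ℕ∞) → n = m := fun hm => by
    rw [hn] at hm
    exact_mod_cast hm
  obtain ⟨a, b, c, ⟨e⟩⟩ := h.exists_equiv hM
  have hxb : ∀ t : Fin b → R ⧸ Ideal.span {x}, x • t = 0 :=
    fun t => funext fun i => smul_quotient_eq_zero (t i)
  have hyc : ∀ t : Fin c → R ⧸ Ideal.span {y}, y • t = 0 :=
    fun t => funext fun i => smul_quotient_eq_zero (t i)
  have hxT : c = 0 → ∀ t : (Fin b → R ⧸ Ideal.span {x}) × (Fin c → R ⧸ Ideal.span {y}),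
      x • t = 0 := by
    rintro rfl t
    exact Prod.ext (hxb _) (Subsingleton.elim _ _)
  have hyT : b = 0 → ∀ t : (Fin b → R ⧸ Ideal.span {x}) × (Fin c → R ⧸ Ideal.span {y}),
      y • t = 0 := by
    rintro rfl t
    exact Prod.ext (Subsingleton.elim _ _) (hyc _)
  rcases Nat.eq_zero_or_pos a with rfl | ha
  · left
    let e' : ((Fin 0 → R) × (Fin b → R ⧸ Ideal.span {x}) × (Fin c → R ⧸ Ideal.span {y})) ≃ₗ[R]
        (Fin b → R ⧸ Ideal.span {x}) × (Fin c → R ⧸ Ideal.span {y}) :=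
      LinearEquiv.ofBijective (LinearMap.snd R _ _)
        ⟨fun s t hst => Prod.ext (Subsingleton.elim _ _) hst, fun t => ⟨(0, t), rfl⟩⟩
    exact cast (h.globalDimEnd_eq_one_of_equiv hM (e.symm.trans e') hxb hyc)
  · have hR := isDirectSummand_self e ha
    right
    rcases Nat.eq_zero_or_pos b with hb | hb
    · have hlx := h.symm.lifts_of_equiv (hyT hb) e
      rcases Nat.eq_zero_or_pos c with hc | hc
      · have hly := h.lifts_of_equiv (hxT hc) e
        exact (h.not_globalDimEnd_le hR hlx hly n hn.le).elim
      · right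
        exact cast (h.symm.globalDimEnd_eq_three (add_comm x y ▸ hM) hR
          (isDirectSummand_quotient_y e hc) hlx)
    · have hx := isDirectSummand_quotient_x e hb
      rcases Nat.eq_zero_or_pos c with hc | hc
      · right
        exact cast (h.globalDimEnd_eq_three hM hR hx (h.lifts_of_equiv (hxT hc) e))
      · left
        exact cast (h.globalDimEnd_eq_two hM hR hx (isDirectSummand_quotient_y e hc))

theorem isSMulRegular_quotient_prod :
    IsSMulRegular ((R ⧸ Ideal.span {x}) × (R ⧸ Ideal.span {y})) (x + y) :=
  isSMulRegular_prod h.isSMulRegular_quotient h.isSMulRegular_quotient'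

theorem globalSpectrum_eq : globalSpectrum R = {1, 2, 3} := by
  have := h.nontrivial_quotient
  have := h.symm.nontrivial_quotient
  ext n
  constructor
  · rintro ⟨M, _, _, hM, hnt, hn⟩
    obtain ⟨hfin, hreg⟩ := h.isMCM_iff.mp hM
    exact h.globalDimEnd_of_nontrivial hreg hn
  · rintro (rfl | rfl | rfl)
    · exact ⟨(R ⧸ Ideal.span {x}) × (R ⧸ Ideal.span {y}), inferInstance, inferInstance,
        h.isMCM_iff.mpr ⟨inferInstance, h.isSMulRegular_quotient_prod⟩, inferInstance,
        h.globalDimEnd_eq_one_of_equiv h.isSMulRegular_quotient_prod (.refl R _)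
          smul_quotient_eq_zero smul_quotient_eq_zero⟩
    · exact ⟨R × (R ⧸ Ideal.span {x}) × (R ⧸ Ideal.span {y}), inferInstance, inferInstance,
        h.isRepresentationGenerator.isMCM, inferInstance, h.globalDimEnd_prod_prod⟩
    · exact ⟨R × R ⧸ Ideal.span {x}, inferInstance, inferInstance,
        h.isClusterTilting.isMCM, inferInstance, h.globalDimEnd_self_prod⟩

end IsNode

/-! ### The normalization -/

namespace IsNode

variable {R : Type u} [CommRing R] [IsLocalRing R] {x y : R} (h : IsNode R x y)
include h

/-- The branch is a Noetherian local domain whose maximal ideal is generated by the class of y. -/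
theorem isIntegrallyClosed_quotient : IsIntegrallyClosed (R ⧸ Ideal.span {x}) := by
  have := h.noetherian
  have := h.prime_x
  have := h.nontrivial_quotient
  have : IsLocalRing (R ⧸ Ideal.span {x}) :=
    IsLocalRing.of_surjective' (Ideal.Quotient.mk _) Ideal.Quotient.mk_surjective
  have hp : (IsLocalRing.maximalIdeal (R ⧸ Ideal.span {x})).IsPrincipal := by
    refine ⟨⟨Ideal.Quotient.mk _ y, le_antisymm (fun z hz => ?_) ?_⟩⟩
    · obtain ⟨r, rfl⟩ := Ideal.Quotient.mk_surjective z
      have hr : r ∈ IsLocalRing.maximalIdeal R := fun hu => hz (hu.map _)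
      obtain ⟨a, b, rfl⟩ := h.exists_of_mem hr
      refine Submodule.mem_span_singleton.mpr ⟨Ideal.Quotient.mk _ b, ?_⟩
      rw [map_add, map_mul, map_mul, Ideal.Quotient.eq_zero_iff_mem.mpr
        (Ideal.mem_span_singleton_self x), mul_zero, zero_add, smul_eq_mul]
    · refine (Submodule.span_singleton_le_iff_mem _ _).mpr fun hu => ?_
      obtain ⟨z, hz⟩ := hu.exists_right_inv
      obtain ⟨r, rfl⟩ := Ideal.Quotient.mk_surjective z
      have h1 : y * r - 1 ∈ Ideal.span {x} := Ideal.Quotient.eq.mp hz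
      obtain ⟨s, hs⟩ := Ideal.mem_span_singleton'.mp h1
      exact h.not_exists_mul_add (-s) r (by linear_combination -hs)
  have htfae := tfae_of_isNoetherianRing_of_isLocalRing_of_isDomain (R ⧸ Ideal.span {x})
  have hiff : (IsIntegrallyClosed (R ⧸ Ideal.span {x}) ∧ ∀ P : Ideal (R ⧸ Ideal.span {x}),
      P ≠ ⊥ → P.IsPrime → P = IsLocalRing.maximalIdeal _) ↔
      (IsLocalRing.maximalIdeal (R ⧸ Ideal.span {x})).IsPrincipal := htfae.out 3 4
  exact (hiff.mpr hp).1

theorem add_mem_nonZeroDivisors : x + y ∈ nonZeroDivisors R := by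
  refine mem_nonZeroDivisors_iff_right.mpr fun a ha => ?_
  exact (isSMulRegular_iff_right_eq_zero_of_smul.mp h.isSMulRegular_self) a
    (by rw [smul_eq_mul, mul_comm, ha])

theorem notMem_of_mem_nonZeroDivisors {s : R} (hs : s ∈ nonZeroDivisors R) :
    s ∉ Ideal.span {x} := by
  intro hsx
  have h1 := h.symm.x_mul_eq_zero_iff.mpr hsx
  rw [mul_right_mem_nonZeroDivisors_eq_zero_iff hs] at h1
  exact h.y_notMem (h1 ▸ Ideal.zero_mem _)

/-- Nonzerodivisors of R avoid (x), so q = r/s maps to Frac(R/x). Its image is integral over the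
integrally closed ring R/x, hence is the class of some `a`. -/
theorem exists_sub_mem_of_isIntegral {q : FractionRing R} (hq : IsIntegral R q) {r s : R}
    (hrs : q * algebraMap R (FractionRing R) s = algebraMap R (FractionRing R) r) :
    ∃ a, r - s * a ∈ Ideal.span {x} := by
  have := h.prime_x
  have := h.isIntegrallyClosed_quotient
  let D := R ⧸ Ideal.span {x}
  let f : R →+* FractionRing D := (algebraMap D (FractionRing D)).comp (Ideal.Quotient.mk _)
  have hf : ∀ s : nonZeroDivisors R, IsUnit (f s) := fun s => by
    refine isUnit_iff_ne_zero.mpr fun h0 => h.notMem_of_mem_nonZeroDivisors s.2 ?_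
    exact Ideal.Quotient.eq_zero_iff_mem.mp
      ((map_eq_zero_iff _ (IsFractionRing.injective D (FractionRing D))).mp h0)
  let g : FractionRing R →+* FractionRing D := IsLocalization.lift hf
  have hg : ∀ r, g (algebraMap R (FractionRing R) r) = f r := IsLocalization.lift_eq hf
  have hgq : IsIntegral D (g q) := hq.map_of_comp_eq (Ideal.Quotient.mk _) g
    (RingHom.ext fun r => (hg r).symm)
  obtain ⟨a, ha⟩ := IsIntegrallyClosed.isIntegral_iff.mp hgq
  obtain ⟨a, rfl⟩ := Ideal.Quotient.mk_surjective a
  refine ⟨a, ?_⟩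
  have h1 := congrArg g hrs
  rw [map_mul, hg, hg, ← ha] at h1
  have h2 : algebraMap D (FractionRing D) (Ideal.Quotient.mk _ (s * a)) =
      algebraMap D (FractionRing D) (Ideal.Quotient.mk _ r) := by
    rw [map_mul, map_mul, mul_comm]
    exact h1
  exact Ideal.Quotient.eq.mp (IsFractionRing.injective D (FractionRing D) h2).symm

theorem nonempty_normalization_equiv :
    Nonempty (Normalization R ≃ₗ[R] (R ⧸ Ideal.span {x}) × (R ⧸ Ideal.span {y})) := by
  let Q := FractionRing R
  let α : R →+* Q := algebraMap R Q
  -- `i` is the inverse of x + y. Then yi and xi are orthogonal idempotents with sum 1, integral as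
  -- roots of T² - T, and the isomorphism sends (a, b) to a·yi + b·xi.
  obtain ⟨i, hi⟩ := (IsLocalization.map_units Q
    (⟨x + y, h.add_mem_nonZeroDivisors⟩ : nonZeroDivisors R)).exists_right_inv
  have hi : (α x + α y) * i = 1 := by rw [← map_add]; exact hi
  have hxy : α x * α y = 0 := by rw [← map_mul, h.mul_eq_zero, map_zero]
  have hidem : ∀ u v : R, α u * α v = 0 → (α u + α v) * i = 1 → IsIntegral R (α u * i) := by
    intro u v huv hi
    refine ⟨Polynomial.X ^ 2 - Polynomial.X, Polynomial.monic_X_pow_sub (by simp), ?_⟩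
    rw [Polynomial.eval₂_sub, Polynomial.eval₂_pow, Polynomial.eval₂_X]
    linear_combination (α u * i) * hi - i ^ 2 * huv
  have hint1 : IsIntegral R (α y * i) :=
    hidem y x (by rw [mul_comm, hxy]) (by rw [add_comm, hi])
  have hint2 : IsIntegral R (α x * i) := hidem x y hxy hi
  let φ : ((R ⧸ Ideal.span {x}) × (R ⧸ Ideal.span {y})) →ₗ[R] Q :=
    ((Ideal.span {x}).liftQ (LinearMap.toSpanSingleton R Q (α y * i)) (by
      rw [Ideal.span, Submodule.span_le, Set.singleton_subset_iff]
      change x • (α y * i) = 0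
      rw [Algebra.smul_def]
      linear_combination i * hxy)).coprod
    ((Ideal.span {y}).liftQ (LinearMap.toSpanSingleton R Q (α x * i)) (by
      rw [Ideal.span, Submodule.span_le, Set.singleton_subset_iff]
      change y • (α x * i) = 0
      rw [Algebra.smul_def]
      linear_combination i * hxy))
  have hφ : ∀ a b, φ (Ideal.Quotient.mk _ a, Ideal.Quotient.mk _ b) =
      α a * (α y * i) + α b * (α x * i) := by
    intro a b
    have h1 : φ (Ideal.Quotient.mk _ a, Ideal.Quotient.mk _ b) =
      a • (α y * i) + b • (α x * i) := rfl
    rw [h1, Algebra.smul_def, Algebra.smul_def]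
  have hφi : ∀ p, φ p ∈ integralClosure R Q := by
    rintro ⟨a, b⟩
    obtain ⟨a, rfl⟩ := Ideal.Quotient.mk_surjective a
    obtain ⟨b, rfl⟩ := Ideal.Quotient.mk_surjective b
    rw [hφ]
    exact Subalgebra.add_mem _ (Subalgebra.mul_mem _ (Subalgebra.algebraMap_mem _ a) hint1)
      (Subalgebra.mul_mem _ (Subalgebra.algebraMap_mem _ b) hint2)
  let ψ : ((R ⧸ Ideal.span {x}) × (R ⧸ Ideal.span {y})) →ₗ[R] Normalization R :=
    { toFun p := ⟨φ p, hφi p⟩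
      map_add' p q := Subtype.ext (map_add φ p q)
      map_smul' r p := Subtype.ext (map_smul φ r p) }
  refine ⟨(LinearEquiv.ofBijective ψ ⟨?_, ?_⟩).symm⟩
  · rw [injective_iff_map_eq_zero]
    rintro ⟨a, b⟩ hab
    obtain ⟨a, rfl⟩ := Ideal.Quotient.mk_surjective a
    obtain ⟨b, rfl⟩ := Ideal.Quotient.mk_surjective b
    have h1 : α a * (α y * i) + α b * (α x * i) = 0 := by
      rw [← hφ]; exact congrArg Subtype.val hab
    have h2 : y * a + x * b = 0 := by
      apply IsFractionRing.injective R Q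
      change α _ = α 0
      rw [map_add, map_mul, map_mul, map_zero]
      linear_combination (α x + α y) * h1 - (α y * α a + α x * α b) * hi
    have h3 : x * b = 0 := h.eq_zero_of_mem (Ideal.mul_mem_right _ _
      (Ideal.mem_span_singleton_self x)) (by
        rw [eq_neg_of_add_eq_zero_right h2]
        exact neg_mem (Ideal.mul_mem_right _ _ (Ideal.mem_span_singleton_self y)))
    rw [h3, add_zero] at h2
    exact Prod.ext (Ideal.Quotient.eq_zero_iff_mem.mpr (h.symm.x_mul_eq_zero_iff.mp h2))
      (Ideal.Quotient.eq_zero_iff_mem.mpr (h.x_mul_eq_zero_iff.mp h3))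
  · rintro ⟨q, hq⟩
    obtain ⟨⟨r, s⟩, hrs⟩ := IsLocalization.surj (nonZeroDivisors R) q
    -- The values of `q` on the two branches give the preimage.
    obtain ⟨a, ha⟩ := h.exists_sub_mem_of_isIntegral hq hrs
    obtain ⟨b, hb⟩ := h.symm.exists_sub_mem_of_isIntegral hq hrs
    refine ⟨(Ideal.Quotient.mk _ a, Ideal.Quotient.mk _ b), Subtype.ext ?_⟩
    change φ _ = q
    rw [hφ]
    have ha' : α y * (α r - α s * α a) = 0 := by
      rw [← map_mul, ← map_sub, ← map_mul, h.symm.x_mul_eq_zero_iff.mpr ha, map_zero]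
    have hb' : α x * (α r - α s * α b) = 0 := by
      rw [← map_mul, ← map_sub, ← map_mul, h.x_mul_eq_zero_iff.mpr hb, map_zero]
    have hrs' : q * α s = α r := hrs
    refine (IsLocalization.map_units Q s).mul_right_cancel ?_
    change _ * α s = _ * α s
    linear_combination (-i) * ha' - i * hb' + α r * hi - hrs'

theorem normalization : IsMCM R (Normalization R) ∧
    Nonempty (Normalization R ≃ₗ[R] (R ⧸ Ideal.span {x}) × (R ⧸ Ideal.span {y})) ∧
    globalDimEnd R (Normalization R) = ((1 : ℕ) : WithBot ℕ∞) := by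
  obtain ⟨e⟩ := h.nonempty_normalization_equiv
  have hreg := (IsDirectSummand.of_equiv e).isSMulRegular h.isSMulRegular_quotient_prod
  have hfin := (IsDirectSummand.of_equiv e).finite
  exact ⟨h.isMCM_iff.mpr ⟨hfin, hreg⟩, ⟨e⟩, h.globalDimEnd_eq_one_of_equiv hreg e
    smul_quotient_eq_zero smul_quotient_eq_zero⟩

end IsNode

/-! ### The ring k[[x,y]]/(xy) is a node -/

section PowerSeries

variable (k : Type u) [Field k]

theorem prime_X_zero : Prime (MvPowerSeries.X 0 : MvPowerSeries (Fin 2) k) := by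
  rw [← MulEquiv.prime_iff (MvPowerSeries.finSuccEquiv k 1).toMulEquiv]
  have h1 := MvPowerSeries.finSuccEquiv_X_zero (R := k) (n := 1)
  have : IsDomain (MvPowerSeries (Fin 1) k) := NoZeroDivisors.to_isDomain _
  exact h1.symm ▸ PowerSeries.X_prime

theorem prime_X_one : Prime (MvPowerSeries.X 1 : MvPowerSeries (Fin 2) k) := by
  rw [← MulEquiv.prime_iff (MvPowerSeries.renameEquiv k (Equiv.swap (0 : Fin 2) 1)).toMulEquiv]
  have : MvPowerSeries.renameEquiv k (Equiv.swap (0 : Fin 2) 1)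
      (MvPowerSeries.X 1 : MvPowerSeries (Fin 2) k) = MvPowerSeries.X 0 :=
    (MvPowerSeries.rename_X _ _).trans (by simp)
  exact this.symm ▸ prime_X_zero k

theorem not_X_dvd_X {i j : Fin 2} (hij : i ≠ j) :
    ¬ (MvPowerSeries.X i : MvPowerSeries (Fin 2) k) ∣ MvPowerSeries.X j := by
  intro hd
  have := MvPowerSeries.X_dvd_iff.mp hd (Finsupp.single j 1) (by simp [hij.symm])
  simp [MvPowerSeries.coeff_X] at this

theorem mem_span_X_of_constantCoeff_eq_zero {f : MvPowerSeries (Fin 2) k}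
    (hf : MvPowerSeries.constantCoeff f = 0) :
    f ∈ Ideal.span {(MvPowerSeries.X 0 : MvPowerSeries (Fin 2) k), MvPowerSeries.X 1} := by
  -- `g` collects the monomials of `f` free of the variable 0. Having no constant term, it is
  -- divisible by the variable 1.
  let g : MvPowerSeries (Fin 2) k := fun m => if m 0 = 0 then MvPowerSeries.coeff m f else 0
  have hg : ∀ m, MvPowerSeries.coeff m g = if m 0 = 0 then MvPowerSeries.coeff m f else 0 :=
    fun m => rfl
  have h0 : (MvPowerSeries.X 0 : MvPowerSeries (Fin 2) k) ∣ f - g :=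
    MvPowerSeries.X_dvd_iff.mpr fun m hm => by rw [map_sub, hg, if_pos hm, sub_self]
  have h1 : (MvPowerSeries.X 1 : MvPowerSeries (Fin 2) k) ∣ g :=
    MvPowerSeries.X_dvd_iff.mpr fun m hm => by
      rw [hg]
      split_ifs with hm0
      · have : m = 0 := by
          ext i
          fin_cases i
          exacts [hm0, hm]
        rw [this]
        exact hf
      · rfl
  rw [← sub_add_cancel f g]
  exact Ideal.add_mem _ (Ideal.mem_of_dvd _ h0 (Ideal.subset_span (by simp)))
    (Ideal.mem_of_dvd _ h1 (Ideal.subset_span (by simp)))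

theorem isPrime_span_mk {f : MvPowerSeries (Fin 2) k} (hf : Prime f)
    (hd : f ∣ MvPowerSeries.X 0 * MvPowerSeries.X 1) :
    (Ideal.span {(Ideal.Quotient.mk _ f : Node k)}).IsPrime := by
  have := (Ideal.span_singleton_prime hf.ne_zero).mpr hf
  rw [show Ideal.span {(Ideal.Quotient.mk _ f : Node k)} =
    (Ideal.span {f}).map (Ideal.Quotient.mk _) by rw [Ideal.map_span, Set.image_singleton]]
  refine Ideal.map_isPrime_of_surjective Ideal.Quotient.mk_surjective ?_
  rw [Ideal.mk_ker]
  exact Ideal.span_singleton_le_span_singleton.mpr hd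

theorem mk_notMem_span_mk {f g : MvPowerSeries (Fin 2) k} (hfg : ¬ f ∣ g)
    (hd : f ∣ MvPowerSeries.X 0 * MvPowerSeries.X 1) :
    (Ideal.Quotient.mk _ g : Node k) ∉ Ideal.span {(Ideal.Quotient.mk _ f : Node k)} := by
  intro hm
  obtain ⟨a, ha⟩ := Ideal.mem_span_singleton'.mp hm
  obtain ⟨a, rfl⟩ := Ideal.Quotient.mk_surjective a
  rw [← map_mul, Ideal.Quotient.eq, Ideal.mem_span_singleton] at ha
  exact hfg ((dvd_sub_right (Dvd.intro_left a rfl)).mp (hd.trans ha))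

theorem isNode : IsNode (Node k) (Node.x k) (Node.y k) where
  noetherian := inferInstance
  maximalIdeal_eq := by
    refine le_antisymm (fun z hz => ?_) ?_
    · obtain ⟨f, rfl⟩ := Ideal.Quotient.mk_surjective z
      have hf : MvPowerSeries.constantCoeff f = 0 := by
        by_contra hne
        exact hz ((MvPowerSeries.isUnit_iff_constantCoeff.mpr (isUnit_iff_ne_zero.mpr hne)).map _)
      have := Ideal.mem_map_of_mem (Ideal.Quotient.mk
        (Ideal.span {(MvPowerSeries.X 0 * MvPowerSeries.X 1 : MvPowerSeries (Fin 2) k)}))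
        (mem_span_X_of_constantCoeff_eq_zero k hf)
      rwa [Ideal.map_span, Set.image_pair] at this
    · rw [Ideal.span_le]
      have key : ∀ i : Fin 2, (Ideal.Quotient.mk _ (MvPowerSeries.X i) : Node k) ∈
          IsLocalRing.maximalIdeal (Node k) := by
        intro i hu
        obtain ⟨z, hz⟩ := hu.exists_right_inv
        obtain ⟨g, rfl⟩ := Ideal.Quotient.mk_surjective z
        rw [← map_mul, ← map_one (Ideal.Quotient.mk _), Ideal.Quotient.eq,
          Ideal.mem_span_singleton] at hz
        have := map_dvd (MvPowerSeries.constantCoeff (σ := Fin 2) (R := k)) hz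
        simp at this
      rintro _ (rfl | rfl)
      exacts [key 0, key 1]
  prime_x := isPrime_span_mk k (prime_X_zero k) (dvd_mul_right _ _)
  prime_y := isPrime_span_mk k (prime_X_one k) (dvd_mul_left _ _)
  x_notMem := mk_notMem_span_mk k (not_X_dvd_X k (by simp)) (dvd_mul_left _ _)
  y_notMem := mk_notMem_span_mk k (not_X_dvd_X k (by simp)) (dvd_mul_right _ _)
  mul_eq_zero := by
    rw [Node.x, Node.y, ← map_mul]
    exact Ideal.Quotient.eq_zero_iff_mem.mpr (Ideal.mem_span_singleton_self _)

end PowerSeries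

end NodeSpectrum


theorem mainTheorem8 (k : Type u) [Field k] :
    -- the global spectrum
    NodeSpectrum.globalSpectrum (NodeSpectrum.Node k) = {1, 2, 3} ∧
    -- the normalization
    (NodeSpectrum.IsMCM (NodeSpectrum.Node k)
        (NodeSpectrum.Normalization (NodeSpectrum.Node k)) ∧
      Nonempty (NodeSpectrum.Normalization (NodeSpectrum.Node k) ≃ₗ[NodeSpectrum.Node k]
        (NodeSpectrum.NPlus k × NodeSpectrum.NMinus k)) ∧
      NodeSpectrum.globalDimEnd (NodeSpectrum.Node k)
        (NodeSpectrum.Normalization (NodeSpectrum.Node k)) = 1) ∧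
    -- the representation generator
    (NodeSpectrum.IsRepresentationGenerator (NodeSpectrum.Node k)
        (NodeSpectrum.Node k × NodeSpectrum.NPlus k × NodeSpectrum.NMinus k) ∧
      NodeSpectrum.globalDimEnd (NodeSpectrum.Node k)
        (NodeSpectrum.Node k × NodeSpectrum.NPlus k × NodeSpectrum.NMinus k) = 2) ∧
    -- the cluster-tilting modules
    (NodeSpectrum.IsClusterTilting (NodeSpectrum.Node k)
        (NodeSpectrum.Node k × NodeSpectrum.NPlus k) ∧
      NodeSpectrum.globalDimEnd (NodeSpectrum.Node k)
        (NodeSpectrum.Node k × NodeSpectrum.NPlus k) = 3) ∧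
    (NodeSpectrum.IsClusterTilting (NodeSpectrum.Node k)
        (NodeSpectrum.Node k × NodeSpectrum.NMinus k) ∧
      NodeSpectrum.globalDimEnd (NodeSpectrum.Node k)
        (NodeSpectrum.Node k × NodeSpectrum.NMinus k) = 3) :=
  have h := NodeSpectrum.isNode k
  ⟨h.globalSpectrum_eq, h.normalization, ⟨h.isRepresentationGenerator, h.globalDimEnd_prod_prod⟩,
    ⟨h.isClusterTilting, h.globalDimEnd_self_prod⟩,
    h.symm.isClusterTilting, h.symm.globalDimEnd_self_prod⟩
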